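/- Let $n\ge 1$ be an integer. For $v=(v_1,\dots,v_n)\in\mathbb{R}^n$ let $\lambda(v)$ (resp. $\widehat\lambda(v)$) be the supremum in $[-\infty,\infty]$ of the real $\eta$ such that, for arbitrarily large real $X$ (resp. for all sufficiently large real $X$), the system $$|x|\le X,\qquad \max_{1\le i\le n}|v_ix-y_i|\le X^{-\eta}$$ has a solution $(x,y_1,\dots,y_n)\in\mathbb{Z}^{n+1}\setminus\{0\}$. Let $w(v)$ (resp. $\widehat w(v)$) be the supremum of the real $\eta$ such that, for arbitrarily large $X$ (resp. for all sufficiently large $X$), the system $$\max_{0\le i\le n}|a_i|\le X,\qquad 0<|a_0+a_1v_1+\cdots+a_nv_n|\le X^{-\eta}$$ has a solution $(a_0,\dots,a_n)\in\mathbb{Z}^{n+1}$. For $\zeta\in\mathbb{R}$ put $\lambda_n(\zeta)=\lambda(\zeta,\zeta^2,\dots,\zeta^n)$ and $\widehat\lambda_n(\zeta)=\widehat\lambda(\zeta,\dots,\zeta^n)$; let $w_n(\zeta)$ and $\widehat w_n(\zeta)$ be the analogous suprema for the system $H(P)\le X$, $0<|P(\zeta)|\le X^{-\eta}$ in polynomials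 $P\in\mathbb{Z}[T]$ of degree at most $n$, where $H(P)$ is the maximal absolute value of the coefficients of $P$. Khintchine's transference inequalities are $$\frac{w}{(n-1)w+n}\le\lambda\le\frac{w-n+1}{n}.$$ If $w=\infty$, the left side is read as its limit ($\frac1{n-1}$ if $n\ge2$, and $\infty$ if $n=1$), and the right side as $\infty$. (a) Let $\zeta$ be a real transcendental number such that equality holds in at least one of these two inequalities for $\lambda=\lambda_n(\zeta)$, $w=w_n(\zeta)$, that is $$n\lambda_n(\zeta)+n-1=w_n(\zeta)\qquad\text{or}\qquad \lambda_n(\zeta)=\frac{w_n(\zeta)}{(n-1)w_n(\zeta)+n}.$$ Then $\widehat\lambda_n(\zeta)=1/n$ and $\widehat w_n(\zeta)=n$. (b) Let $v\in\mathbb{R}^n$ be such that $1,v_1,\dots,v_n$ are linearly independent over $\mathbb{Q}$. Suppose that, for $\lambda=\lambda(v)$ and $w=w(v)$, equality holds in the left inequality, or equality holds in the right inequality with $\lambda(v)<\infty$. Then $\widehat\lambda(v)=1/n$ and $\widehat w(v)=n$. -/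

import Mathlib

open Filter Polynomial

/-- The supremum in `[-∞, ∞]` of a set of real exponents. -/
noncomputable def expSup (S : Set ℝ) : EReal := sSup ((fun η : ℝ => (η : EReal)) '' S)

/-- There is a nonzero integer vector `(x, y₁, …, yₙ)` with `|x| ≤ X` and
`max |v i * x - y i| ≤ X ^ (-η)`. -/
def SimSolvable {n : ℕ} (v : Fin n → ℝ) (η X : ℝ) : Prop :=
  ∃ (x : ℤ) (y : Fin n → ℤ), (x ≠ 0 ∨ y ≠ 0) ∧
    |(x : ℝ)| ≤ X ∧ ∀ i, |v i * x - y i| ≤ X ^ (-η)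

/-- There is an integer linear form `a₀ + a₁ T₁ + ⋯ + aₙ Tₙ` with all coefficients (including `a₀`)
at most `X` in absolute value, whose value at `v` is nonzero and at most `X ^ (-η)` in absolute
value. -/
def FormSolvable {n : ℕ} (v : Fin n → ℝ) (η X : ℝ) : Prop :=
  ∃ (a₀ : ℤ) (a : Fin n → ℤ),
    (|(a₀ : ℝ)| ≤ X ∧ ∀ i, |(a i : ℝ)| ≤ X) ∧
    0 < |(a₀ : ℝ) + ∑ i, (a i : ℝ) * v i| ∧
    |(a₀ : ℝ) + ∑ i, (a i : ℝ) * v i| ≤ X ^ (-η)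

/-- There is an integer polynomial `P` of degree at most `n` with `H(P) ≤ X` and
`0 < |P(ζ)| ≤ X ^ (-η)`. -/
def PolySolvable (n : ℕ) (ζ η X : ℝ) : Prop :=
  ∃ P : ℤ[X], P.natDegree ≤ n ∧ (∀ i, |(P.coeff i : ℝ)| ≤ X) ∧
    0 < |aeval ζ P| ∧ |aeval ζ P| ≤ X ^ (-η)

/-- Ordinary exponent `λ` of simultaneous approximation to a vector. -/
noncomputable def lamVec {n : ℕ} (v : Fin n → ℝ) : EReal :=
  expSup {η | ∃ᶠ X : ℝ in atTop, SimSolvable v η X}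

/-- Uniform exponent `λ̂` of simultaneous approximation to a vector. -/
noncomputable def lamHatVec {n : ℕ} (v : Fin n → ℝ) : EReal :=
  expSup {η | ∀ᶠ X : ℝ in atTop, SimSolvable v η X}

/-- Ordinary exponent `w` of approximation to a vector by one linear form. -/
noncomputable def wVec {n : ℕ} (v : Fin n → ℝ) : EReal :=
  expSup {η | ∃ᶠ X : ℝ in atTop, FormSolvable v η X}

/-- Uniform exponent `ŵ` of approximation to a vector by one linear form. -/
noncomputable def wHatVec {n : ℕ} (v : Fin n → ℝ) : EReal :=
  expSup {η | ∀ᶠ X : ℝ in atTop, FormSolvable v η X}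

/-- The point `(ζ, ζ², …, ζⁿ)`. -/
def veronese (n : ℕ) (ζ : ℝ) : Fin n → ℝ := fun i => ζ ^ ((i : ℕ) + 1)

/-- `λ_n(ζ)`. -/
noncomputable def lam (n : ℕ) (ζ : ℝ) : EReal := lamVec (veronese n ζ)

/-- `λ̂_n(ζ)`. -/
noncomputable def lamHat (n : ℕ) (ζ : ℝ) : EReal := lamHatVec (veronese n ζ)

/-- `w_n(ζ)`. -/
noncomputable def wExp (n : ℕ) (ζ : ℝ) : EReal :=
  expSup {η | ∃ᶠ X : ℝ in atTop, PolySolvable n ζ η X}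

/-- `ŵ_n(ζ)`. -/
noncomputable def wHat (n : ℕ) (ζ : ℝ) : EReal :=
  expSup {η | ∀ᶠ X : ℝ in atTop, PolySolvable n ζ η X}

open Classical in
/-- The lower bound `w / ((n - 1) w + n)` of Khintchine's transference inequalities. For `w = ∞` it
is read as its limit, namely `1 / (n - 1)` if `n ≥ 2` and `∞` if `n = 1`. -/
noncomputable def khintchineLower (n : ℕ) (w : EReal) : EReal :=
  if w = ⊤ then (if n = 1 then ⊤ else ((1 / ((n : ℝ) - 1) : ℝ) : EReal))
  else w / (((n : EReal) - 1) * w + n)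

/-- Equality in the lower Khintchine inequality: `λ = w / ((n - 1) w + n)`. -/
def KhintchineLeftEq (n : ℕ) (l w : EReal) : Prop := l = khintchineLower n w

/-- Equality in the upper Khintchine inequality `λ ≤ (w - n + 1) / n`, that is
`n λ + n - 1 = w`; for infinite exponents this reads `λ = w = ∞`. -/
def KhintchineRightEq (n : ℕ) (l w : EReal) : Prop := (n : EReal) * l + n - 1 = w

/-!
Suppose that one of the uniform exponents exceeds its Dirichlet value, that is `λ̂ > 1/n` or `ŵ > n`.
By transference the other one exceeds its Dirichlet value as well, and it is shown that both of
Khintchine's inequalities are then strict, except for the upper one when `λ = ∞`.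

Khintchine's inequalities arise as follows. An integer point `x` is an integer-valued linear form on
the lattice of integer linear forms, and conversely. A good approximation on one side therefore cuts
out a sublattice of small covolume on the other side, and Minkowski's theorem gives a good
approximation there. If the uniform exponent is large, the good approximation has a linearly
independent companion, a neighbour in the sequence of best approximations, which is also quite good.
Minkowski's theorem applied to the sublattice of rank `n - 1` orthogonal to both gives a strictly
better result. The companion has to be chosen on the correct side: for a point with least `|x|`
among those of the same quality it is an earlier point, with smaller `|x|`
(`frequently_hasForm_of_simSolvable`, leading to `not_khintchineRightEq`), and for a linear form of
least height it is a later one, with smaller value (`frequently_hasSimPoint_of_formSolvable`,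
leading to `not_khintchineLeftEq`).

The sublattice is never constructed. In `exists_int_of_two_forms` two of the coordinate forms are
replaced by the two given integer-valued forms; where these are smaller than one in absolute value,
they vanish, and Cramer's rule then bounds the two missing coordinates.

What remains is a point `(ζ, …, ζⁿ)` with `λ = ∞`. Then `ζ` is a Liouville number, and a polynomial
of height less than the denominator `q` of a rational number very close to `ζ` does not vanish there
by the rational root theorem, so its value at `ζ` is at least about `q⁻ⁿ`; this gives `ŵ ≤ n`.
-/

/-! ### Minkowski's theorem and linear forms -/

/-- Minkowski's theorem on linear forms. -/
theorem exists_int_abs_mulVec_lt {ι : Type*} [Fintype ι] [DecidableEq ι] (M : Matrix ι ι ℝ)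
    (hM : M.det ≠ 0) (c : ι → ℝ) (hc : ∀ i, 0 < c i) (h : |M.det| < ∏ i, c i) :
    ∃ x : ι → ℤ, x ≠ 0 ∧ ∀ i, |M.mulVec (fun k => (x k : ℝ)) i| < c i := by
  classical
  set b := Pi.basisFun ℝ ι
  have fund := ZSpan.isAddFundamentalDomain' b MeasureTheory.volume
  set s : Set (ι → ℝ) := (Matrix.toLin' M) ⁻¹' (Set.univ.pi fun i => Set.Ioo (-c i) (c i)) with hs
  have hdet : LinearMap.det (Matrix.toLin' M) ≠ 0 := by rwa [LinearMap.det_toLin']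
  have hconv : Convex ℝ s :=
    (convex_pi fun i _ => convex_Ioo _ _).linear_preimage (Matrix.toLin' M)
  have hsymm : ∀ x ∈ s, -x ∈ s := by
    intro x hx
    simp only [hs, Set.mem_preimage, Set.mem_pi, Set.mem_univ, true_imp_iff, Set.mem_Ioo,
      map_neg, Pi.neg_apply] at hx ⊢
    intro i
    constructor <;> linarith [(hx i).1, (hx i).2]
  have hvol : MeasureTheory.volume (ZSpan.fundamentalDomain b) * 2 ^ Module.finrank ℝ (ι → ℝ)
      < MeasureTheory.volume s := by
    have h1 : MeasureTheory.volume (ZSpan.fundamentalDomain b) = 1 := by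
      rw [ZSpan.volume_fundamentalDomain]
      have : Matrix.of b = 1 := by
        ext i j
        simp [b, Pi.basisFun_apply, Matrix.one_apply, Pi.single_apply, eq_comm]
      rw [this]; simp
    rw [h1, hs, MeasureTheory.Measure.addHaar_preimage_linearMap _ hdet, LinearMap.det_toLin',
      Real.volume_pi_Ioo, Module.finrank_fintype_fun_eq_card, one_mul,
      ← ENNReal.ofReal_prod_of_nonneg (fun i _ => by linarith [hc i]),
      ← ENNReal.ofReal_mul (abs_nonneg _)]
    have h2 : (2 : ENNReal) ^ Fintype.card ι = ENNReal.ofReal (2 ^ Fintype.card ι) := by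
      rw [ENNReal.ofReal_pow (by norm_num)]; simp
    rw [h2]
    have h3 : ∏ i, (c i - -c i) = 2 ^ Fintype.card ι * ∏ i, c i := by
      rw [← Finset.card_univ, ← Finset.prod_const, ← Finset.prod_mul_distrib]
      exact Finset.prod_congr rfl fun i _ => by ring
    have hdpos : 0 < |M.det| := abs_pos.2 hM
    have hP : 0 < ∏ i, c i := Finset.prod_pos fun i _ => hc i
    rw [h3, abs_inv]
    refine (ENNReal.ofReal_lt_ofReal_iff (by positivity)).2 ?_
    rw [inv_mul_eq_div, lt_div_iff₀ hdpos]
    exact mul_lt_mul_of_pos_left h (by positivity)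
  have : Countable (Submodule.span ℤ (Set.range b)).toAddSubgroup :=
    inferInstanceAs (Countable (Submodule.span ℤ (Set.range b)))
  obtain ⟨⟨x, hxL⟩, hx0, hxs⟩ :=
    MeasureTheory.exists_ne_zero_mem_lattice_of_measure_mul_two_pow_lt_measure
      fund hsymm hconv hvol
  have hx : ∀ i, ∃ m : ℤ, (m : ℝ) = x i := by
    have := (b.mem_span_iff_repr_mem ℤ x).1 hxL
    intro i
    simpa [b] using this i
  choose y hy using hx
  have hyx : (fun k => (y k : ℝ)) = x := funext hy
  refine ⟨y, ?_, ?_⟩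
  · rintro rfl
    apply hx0
    ext i
    simpa using (hy i).symm
  · intro i
    rw [hyx]
    simp only [hs, Set.mem_preimage, Set.mem_pi, Set.mem_univ, true_imp_iff, Set.mem_Ioo] at hxs
    exact abs_lt.2 (hxs i)

/-! ### Lattice points orthogonal to one or two dual lattice points -/

/-- A coordinate on which a vanishing linear combination depends most is controlled by the
others. -/
theorem abs_le_of_sum_mul_eq_zero {ι : Type*} [Fintype ι] {α z : ι → ℝ} (hz : ∑ k, α k * z k = 0)
    {i : ι} (hi : α i ≠ 0) {E : ℝ} (hE : 0 ≤ E)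
    (h : ∀ k, k ≠ i → |α k| * |z k| ≤ |α i| * E) :
    |z i| ≤ Fintype.card ι * E := by
  classical
  have h1 : α i * z i = -∑ k ∈ Finset.univ.erase i, α k * z k := by
    rw [← Finset.add_sum_erase _ _ (Finset.mem_univ i)] at hz
    linarith
  have h2 : |α i| * |z i| ≤ Fintype.card ι * (|α i| * E) := by
    rw [← abs_mul, h1, abs_neg]
    refine (Finset.abs_sum_le_sum_abs _ _).trans ?_
    have : ∀ k ∈ Finset.univ.erase i, |α k * z k| ≤ |α i| * E := fun k hk => by
      rw [abs_mul]; exact h k (Finset.ne_of_mem_erase hk)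
    refine (Finset.sum_le_card_nsmul _ _ _ this).trans ?_
    rw [nsmul_eq_mul]
    refine mul_le_mul_of_nonneg_right ?_ (by positivity)
    exact_mod_cast (Finset.card_le_univ _)
  have h3 : 0 < |α i| := abs_pos.2 hi
  refine le_of_mul_le_mul_left ?_ h3
  linarith

theorem det_updateRow_one {ι : Type*} [Fintype ι] [DecidableEq ι] (i : ι) (α : ι → ℝ) :
    ((1 : Matrix ι ι ℝ).updateRow i α).det = α i := by
  rw [← Matrix.cramer_transpose_apply, Matrix.transpose_one, Matrix.cramer_one]
  rfl

/-- The determinant of the identity matrix with rows `i` and `j` replaced is a `2 × 2` minor of the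
new rows. -/
theorem det_updateRow_updateRow_one {ι : Type*} [Fintype ι] [DecidableEq ι] {i j : ι}
    (hij : i ≠ j) (α β : ι → ℝ) (hi : α i ≠ 0) :
    (((1 : Matrix ι ι ℝ).updateRow i α).updateRow j β).det = α i * β j - α j * β i := by
  set A := (1 : Matrix ι ι ℝ).updateRow i α with hA
  have hAdet : A.det = α i := det_updateRow_one i α
  -- `α i • β` is a combination of the rows of `A`
  have key : α i • β = ∑ k, (if k = i then β i else α i * β k - α k * β i) • A k := by
    have hrow : ∀ k, k ≠ i → A k = Pi.single k 1 := fun k hk => by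
      rw [hA, Matrix.updateRow_ne hk]
      ext l
      simp [Matrix.one_apply, Pi.single_apply, eq_comm]
    have hrow' : A i = α := by rw [hA, Matrix.updateRow_self]
    ext l
    rw [← Finset.add_sum_erase _ _ (Finset.mem_univ i), if_pos rfl, hrow']
    have h2 : ∑ k ∈ Finset.univ.erase i, (if k = i then β i else α i * β k - α k * β i) • A k
        = ∑ k ∈ Finset.univ.erase i, (α i * β k - α k * β i) • (Pi.single k 1 : ι → ℝ) :=
      Finset.sum_congr rfl fun k hk => by
        rw [if_neg (Finset.ne_of_mem_erase hk), hrow k (Finset.ne_of_mem_erase hk)]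
    rw [h2]
    simp only [Pi.add_apply, Pi.smul_apply, Finset.sum_apply, smul_eq_mul, Pi.single_apply]
    by_cases hl : l = i
    · subst hl
      rw [Finset.sum_eq_zero]
      · ring
      · intro k hk
        rw [if_neg (Finset.ne_of_mem_erase hk).symm, mul_zero]
    · rw [Finset.sum_eq_single_of_mem l (Finset.mem_erase.2 ⟨hl, Finset.mem_univ _⟩)]
      · rw [if_pos rfl]; ring
      · intro k _ hkl
        rw [if_neg hkl.symm, mul_zero]
  have h1 : α i * (A.updateRow j β).det = α i * (α i * β j - α j * β i) := by
    rw [← Matrix.det_updateRow_smul, key, Matrix.det_updateRow_sum, if_neg hij.symm, hAdet,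
      smul_eq_mul, mul_comm]
  exact mul_left_cancel₀ hi h1

theorem eq_zero_of_abs_lt_one_of_int {r : ℝ} (h : ∃ m : ℤ, r = m) (h1 : |r| < 1) : r = 0 := by
  obtain ⟨m, rfl⟩ := h
  have : |m| < 1 := by exact_mod_cast h1
  rw [Int.abs_lt_one_iff.1 this, Int.cast_zero]

theorem prod_update_one_mul {ι : Type*} [Fintype ι] [DecidableEq ι] (c : ι → ℝ) (i : ι) :
    (∏ k, Function.update c i 1 k) * c i = ∏ k, c k := by
  rw [Finset.prod_update_of_mem (Finset.mem_univ i), one_mul, Finset.sdiff_singleton_eq_erase,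
    Finset.prod_erase_mul _ _ (Finset.mem_univ i)]

theorem updateRow_mulVec_self {ι : Type*} [Fintype ι] [DecidableEq ι] (M : Matrix ι ι ℝ) (i : ι)
    (α z : ι → ℝ) : (M.updateRow i α).mulVec z i = ∑ k, α k * z k := by
  simp [Matrix.mulVec, dotProduct]

theorem updateRow_mulVec_of_ne {ι : Type*} [Fintype ι] [DecidableEq ι] (M : Matrix ι ι ℝ)
    {i k : ι} (hk : k ≠ i) (α z : ι → ℝ) : (M.updateRow i α).mulVec z k = M.mulVec z k := by
  simp [Matrix.mulVec, dotProduct, Matrix.updateRow_ne hk]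

/-- Transference through one dual vector: if a nonzero linear form `α` takes integer values on the
lattice `B ℤ^ι` of covolume one and is small on the box with half-sides `c`, then the lattice has a
nonzero point in a fixed multiple of that box. -/
theorem exists_int_of_one_form {ι : Type*} [Fintype ι] [DecidableEq ι] (B : Matrix ι ι ℝ)
    (hB : |B.det| = 1) (α : ι → ℝ)
    (hα : ∀ x : ι → ℤ, ∃ m : ℤ, ∑ k, α k * B.mulVec (fun k => (x k : ℝ)) k = m)
    (hne : α ≠ 0) (c : ι → ℝ) (hc : ∀ i, 0 < c i) (h : ∀ k, |α k| * c k < ∏ i, c i) :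
    ∃ x : ι → ℤ, x ≠ 0 ∧
      ∀ k, |B.mulVec (fun k => (x k : ℝ)) k| ≤ (Fintype.card ι : ℝ) ^ 2 * c k := by
  obtain ⟨k₀, hk₀⟩ := Function.ne_iff.1 hne
  have : Nonempty ι := ⟨k₀⟩
  obtain ⟨i, hi⟩ := Finite.exists_max fun k => |α k| * c k
  have hαi : α i ≠ 0 := by
    intro h0
    have h1 := hi k₀
    rw [h0, abs_zero, zero_mul] at h1
    exact absurd h1 (not_le.2 (mul_pos (abs_pos.2 hk₀) (hc _)))
  set N := (1 : Matrix ι ι ℝ).updateRow i α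
  have hN : N.det = α i := det_updateRow_one i α
  have hNB : |(N * B).det| = |α i| := by rw [Matrix.det_mul, abs_mul, hB, mul_one, hN]
  have hprod := prod_update_one_mul c i
  obtain ⟨x, hx0, hx⟩ := exists_int_abs_mulVec_lt (N * B)
    (abs_pos.1 (by rw [hNB]; exact abs_pos.2 hαi)) (Function.update c i 1)
    (fun k => by by_cases hk : k = i <;> simp [hk, hc])
    (by
      rw [hNB]
      refine lt_of_mul_lt_mul_right ?_ (hc i).le
      rw [hprod]; exact h i)
  set z := B.mulVec (fun k => (x k : ℝ)) with hz
  have hcard : (1 : ℝ) ≤ Fintype.card ι := by exact_mod_cast Fintype.card_pos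
  have hrow : ∀ k, k ≠ i → |z k| < c k := by
    intro k hk
    have := hx k
    rwa [← Matrix.mulVec_mulVec, Function.update_of_ne hk, updateRow_mulVec_of_ne _ hk,
      Matrix.one_mulVec] at this
  have hαz : ∑ k, α k * z k = 0 := by
    refine eq_zero_of_abs_lt_one_of_int (hα x) ?_
    have := hx i
    rwa [← Matrix.mulVec_mulVec, Function.update_self, updateRow_mulVec_self] at this
  have hzi : |z i| ≤ Fintype.card ι * c i := by
    refine abs_le_of_sum_mul_eq_zero hαz hαi (hc i).le fun k hk => ?_
    exact (mul_le_mul_of_nonneg_left (hrow k hk).le (abs_nonneg _)).trans (hi k)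
  refine ⟨x, hx0, fun k => ?_⟩
  have hck := hc k
  by_cases hk : k = i
  · subst hk
    refine hzi.trans (mul_le_mul_of_nonneg_right ?_ hck.le)
    nlinarith
  · refine (hrow k hk).le.trans ?_
    have : (1 : ℝ) ≤ (Fintype.card ι : ℝ) ^ 2 := by nlinarith
    nlinarith

/-- Transference through two dual vectors: if two linearly independent linear forms `α`, `β` take
integer values on the lattice `B ℤ^ι` of covolume one and all their minors, weighted by the box with
half-sides `c`, are smaller than the volume of that box, then the lattice has a nonzero point in a
fixed multiple of the box. -/
theorem exists_int_of_two_forms {ι : Type*} [Fintype ι] [DecidableEq ι] (B : Matrix ι ι ℝ)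
    (hB : |B.det| = 1) (α β : ι → ℝ)
    (hα : ∀ x : ι → ℤ, ∃ m : ℤ, ∑ k, α k * B.mulVec (fun k => (x k : ℝ)) k = m)
    (hβ : ∀ x : ι → ℤ, ∃ m : ℤ, ∑ k, β k * B.mulVec (fun k => (x k : ℝ)) k = m)
    (hne : ∃ k l, α k * β l - α l * β k ≠ 0) (c : ι → ℝ) (hc : ∀ i, 0 < c i)
    (h : ∀ k l, k ≠ l → |α k * β l - α l * β k| * c k * c l < ∏ i, c i) :
    ∃ x : ι → ℤ, x ≠ 0 ∧
      ∀ k, |B.mulVec (fun k => (x k : ℝ)) k| ≤ (Fintype.card ι : ℝ) ^ 2 * c k := by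
  obtain ⟨k₀, l₀, hkl⟩ := hne
  have : Nonempty ι := ⟨k₀⟩
  -- pivots: first the largest weighted entry of `α`, then the largest weighted minor using it
  obtain ⟨i, hi⟩ := Finite.exists_max fun k => |α k| * c k
  have hαi : α i ≠ 0 := by
    intro h0
    have h1 : ∀ k, α k = 0 := fun k => by
      have h1 := hi k
      rw [h0, abs_zero, zero_mul] at h1
      by_contra hk
      exact absurd h1 (not_le.2 (mul_pos (abs_pos.2 hk) (hc _)))
    apply hkl; rw [h1, h1]; ring
  set m : ι → ℝ := fun k => α i * β k - α k * β i with hm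
  obtain ⟨j, hj⟩ := Finite.exists_max fun k => |m k| * c k
  have hmj : m j ≠ 0 := by
    intro h0
    have h1 : ∀ k, m k = 0 := fun k => by
      have h1 := hj k
      rw [h0, abs_zero, zero_mul] at h1
      by_contra hk
      exact absurd h1 (not_le.2 (mul_pos (abs_pos.2 hk) (hc _)))
    apply hkl
    have h2 : α i * (α k₀ * β l₀ - α l₀ * β k₀) = α k₀ * m l₀ - α l₀ * m k₀ := by
      simp only [hm]; ring
    rw [h1, h1, mul_zero, mul_zero, sub_zero] at h2
    exact (mul_eq_zero.1 h2).resolve_left hαi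
  have hij : i ≠ j := by
    rintro rfl
    apply hmj
    simp only [hm]; ring
  set N := ((1 : Matrix ι ι ℝ).updateRow i α).updateRow j β
  have hN : N.det = m j := det_updateRow_updateRow_one hij α β hαi
  have hNB : |(N * B).det| = |m j| := by rw [Matrix.det_mul, abs_mul, hB, mul_one, hN]
  set γ := Function.update (Function.update c i 1) j 1 with hγ
  have hγpos : ∀ k, 0 < γ k := fun k => by
    by_cases hk : k = j
    · simp [hγ, hk]
    · by_cases hk' : k = i <;> simp [hγ, Function.update_of_ne hk, hk', hc, hij]
  have hprod : (∏ k, γ k) * c i * c j = ∏ k, c k := by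
    have h2 := prod_update_one_mul (Function.update c i 1) j
    rw [Function.update_of_ne hij.symm] at h2
    rw [← prod_update_one_mul c i, ← h2]; ring
  obtain ⟨x, hx0, hx⟩ := exists_int_abs_mulVec_lt (N * B)
    (abs_pos.1 (by rw [hNB]; exact abs_pos.2 hmj)) γ hγpos
    (by
      rw [hNB]
      refine lt_of_mul_lt_mul_right ?_ (hc i).le
      refine lt_of_mul_lt_mul_right ?_ (hc j).le
      rw [hprod]; exact h i j hij)
  set z := B.mulVec (fun k => (x k : ℝ)) with hz
  have hcard : (1 : ℝ) ≤ Fintype.card ι := by exact_mod_cast Fintype.card_pos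
  have hrow : ∀ k, k ≠ i → k ≠ j → |z k| < c k := by
    intro k hk hk'
    have := hx k
    rwa [← Matrix.mulVec_mulVec, hγ, Function.update_of_ne hk', Function.update_of_ne hk,
      updateRow_mulVec_of_ne _ hk', updateRow_mulVec_of_ne _ hk, Matrix.one_mulVec] at this
  have hαz : ∑ k, α k * z k = 0 := by
    refine eq_zero_of_abs_lt_one_of_int (hα x) ?_
    have := hx i
    rwa [← Matrix.mulVec_mulVec, hγ, Function.update_of_ne hij, Function.update_self,
      updateRow_mulVec_of_ne _ hij, updateRow_mulVec_self] at this
  have hβz : ∑ k, β k * z k = 0 := by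
    refine eq_zero_of_abs_lt_one_of_int (hβ x) ?_
    have := hx j
    rwa [← Matrix.mulVec_mulVec, hγ, Function.update_self, updateRow_mulVec_self] at this
  have hmz : ∑ k, m k * z k = 0 := by
    have h1 : ∑ k, m k * z k = α i * ∑ k, β k * z k - β i * ∑ k, α k * z k := by
      rw [Finset.mul_sum, Finset.mul_sum, ← Finset.sum_sub_distrib]
      exact Finset.sum_congr rfl fun k _ => by simp only [hm]; ring
    rw [h1, hαz, hβz]; ring
  have hzj : |z j| ≤ Fintype.card ι * c j := by
    refine abs_le_of_sum_mul_eq_zero hmz hmj (hc j).le fun k hk => ?_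
    by_cases hki : k = i
    · have : m k = 0 := by rw [hki]; simp only [hm]; ring
      rw [this, abs_zero, zero_mul]
      have := hc j
      positivity
    · exact (mul_le_mul_of_nonneg_left (hrow k hki hk).le (abs_nonneg _)).trans (hj k)
  have hzk : ∀ k, k ≠ i → |z k| ≤ Fintype.card ι * c k := by
    intro k hk
    by_cases hkj : k = j
    · rw [hkj]; exact hzj
    · exact (hrow k hk hkj).le.trans (le_mul_of_one_le_left (hc k).le hcard)
  have hzi : |z i| ≤ Fintype.card ι * (Fintype.card ι * c i) := by
    refine abs_le_of_sum_mul_eq_zero hαz hαi (by have := hc i; positivity) fun k hk => ?_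
    refine (mul_le_mul_of_nonneg_left (hzk k hk) (abs_nonneg _)).trans ?_
    have := mul_le_mul_of_nonneg_left (hi k) (zero_le_one.trans hcard)
    linarith
  refine ⟨x, hx0, fun k => ?_⟩
  have hck := hc k
  by_cases hk : k = i
  · subst hk
    linarith
  · refine (hzk k hk).trans (mul_le_mul_of_nonneg_right ?_ hck.le)
    nlinarith

/-! ### Powers of a large parameter -/

theorem eventually_const_mul_rpow_lt (K : ℝ) {e e' : ℝ} (h : e < e') :
    ∀ᶠ T : ℝ in atTop, K * T ^ e < T ^ e' := by
  filter_upwards [(tendsto_rpow_atTop (sub_pos.2 h)).eventually_gt_atTop K,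
    eventually_gt_atTop 0] with T hT hT0
  rw [Real.rpow_sub hT0, lt_div_iff₀ (Real.rpow_pos_of_pos hT0 _)] at hT
  exact hT

theorem eventually_of_eventually_rpow {P : ℝ → Prop} {p : ℝ} (hp : 0 < p)
    (h : ∀ᶠ T : ℝ in atTop, P (T ^ p)) : ∀ᶠ X : ℝ in atTop, P X := by
  filter_upwards [(tendsto_rpow_atTop (inv_pos.2 hp)).eventually h, eventually_ge_atTop 0]
    with X hX hX0
  rwa [Real.rpow_inv_rpow hX0 hp.ne'] at hX

theorem frequently_of_frequently_rpow {P : ℝ → Prop} {p : ℝ} (hp : 0 < p)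
    (h : ∃ᶠ T : ℝ in atTop, P (T ^ p)) : ∃ᶠ X : ℝ in atTop, P X :=
  (tendsto_rpow_atTop hp).frequently h

/-! ### Transference in boxes whose sides are powers of a parameter -/

/-- Minkowski's theorem for a lattice of covolume one and the box with half-sides
`T ^ q₀, T ^ q, …, T ^ q`, of which there are `n + 1`. -/
theorem exists_int_box {n : ℕ} (B : Matrix (Fin (n + 1)) (Fin (n + 1)) ℝ) (hB : |B.det| = 1)
    {q₀ q T : ℝ} (hT : 1 < T) (hq : 0 < q₀ + n * q) :
    ∃ x : Fin (n + 1) → ℤ, x ≠ 0 ∧ |B.mulVec (fun k => (x k : ℝ)) 0| ≤ T ^ q₀ ∧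
      ∀ i : Fin n, |B.mulVec (fun k => (x k : ℝ)) i.succ| ≤ T ^ q := by
  have hT0 : 0 < T := by linarith
  obtain ⟨x, hx0, hx⟩ := exists_int_abs_mulVec_lt B (abs_pos.1 (by rw [hB]; exact one_pos))
    (Fin.cons (T ^ q₀) fun _ => T ^ q)
    (fun k => by refine Fin.cases ?_ (fun i => ?_) k <;> simp [Real.rpow_pos_of_pos hT0])
    (by
      rw [hB, Fin.prod_univ_succ]
      simp only [Fin.cons_zero, Fin.cons_succ, Finset.prod_const, Finset.card_univ,
        Fintype.card_fin]
      rw [← Real.rpow_mul_natCast hT0.le, ← Real.rpow_add hT0]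
      exact Real.one_lt_rpow hT (by linarith))
  refine ⟨x, hx0, ?_, fun i => ?_⟩
  · simpa using (hx 0).le
  · simpa using (hx i.succ).le

/-- `exists_int_of_one_form` for the box with half-sides `T ^ q₀, T ^ q, …, T ^ q`. -/
theorem exists_int_box_of_one_form {n : ℕ} (B : Matrix (Fin (n + 1)) (Fin (n + 1)) ℝ)
    (hB : |B.det| = 1) {q₀ q e₀ e₁ T : ℝ} (hT : 1 < T) (h₀ : e₀ < n * q)
    (h₁ : e₁ < q₀ + (n - 1) * q) (α : Fin (n + 1) → ℝ)
    (hα : ∀ x : Fin (n + 1) → ℤ, ∃ m : ℤ, ∑ k, α k * B.mulVec (fun k => (x k : ℝ)) k = m)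
    (hne : α ≠ 0) (hα₀ : |α 0| ≤ T ^ e₀) (hα₁ : ∀ i : Fin n, |α i.succ| ≤ T ^ e₁) :
    ∃ x : Fin (n + 1) → ℤ, x ≠ 0 ∧
      |B.mulVec (fun k => (x k : ℝ)) 0| ≤ ((n : ℝ) + 1) ^ 2 * T ^ q₀ ∧
      ∀ i : Fin n, |B.mulVec (fun k => (x k : ℝ)) i.succ| ≤ ((n : ℝ) + 1) ^ 2 * T ^ q := by
  have hT0 : 0 < T := by linarith
  obtain ⟨x, hx0, hx⟩ := exists_int_of_one_form B hB α hα hne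
    (Fin.cons (T ^ q₀) fun _ => T ^ q)
    (fun k => by refine Fin.cases ?_ (fun i => ?_) k <;> simp [Real.rpow_pos_of_pos hT0])
    (by
      rw [Fin.prod_univ_succ]
      simp only [Fin.cons_zero, Fin.cons_succ, Finset.prod_const, Finset.card_univ,
        Fintype.card_fin]
      rw [← Real.rpow_mul_natCast hT0.le, ← Real.rpow_add hT0]
      refine fun k => Fin.cases ?_ (fun i => ?_) k
      · refine (mul_le_mul_of_nonneg_right hα₀
          (by simpa using (Real.rpow_pos_of_pos hT0 _).le)).trans_lt ?_
        rw [Fin.cons_zero, ← Real.rpow_add hT0]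
        exact Real.rpow_lt_rpow_of_exponent_lt hT (by linarith)
      · refine (mul_le_mul_of_nonneg_right (hα₁ i)
          (by simpa using (Real.rpow_pos_of_pos hT0 _).le)).trans_lt ?_
        rw [Fin.cons_succ, ← Real.rpow_add hT0]
        exact Real.rpow_lt_rpow_of_exponent_lt hT (by linarith))
  refine ⟨x, hx0, ?_, fun i => ?_⟩
  · simpa using hx 0
  · simpa using hx i.succ

/-- `exists_int_of_two_forms` for the box with half-sides `T ^ q₀, T ^ q, …, T ^ q`. The strict
inequalities between the exponents absorb the constant `D` in the bounds for the minors. -/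
theorem exists_int_box_of_two_forms {n : ℕ} (B : Matrix (Fin (n + 1)) (Fin (n + 1)) ℝ)
    (hB : |B.det| = 1) (D : ℝ) {q₀ q e₀ e₁ : ℝ} (h₀ : e₀ < (n - 1) * q)
    (h₁ : e₁ < q₀ + (n - 2) * q) :
    ∀ᶠ T : ℝ in atTop, ∀ α β : Fin (n + 1) → ℝ,
    (∀ x : Fin (n + 1) → ℤ, ∃ m : ℤ, ∑ k, α k * B.mulVec (fun k => (x k : ℝ)) k = m) →
    (∀ x : Fin (n + 1) → ℤ, ∃ m : ℤ, ∑ k, β k * B.mulVec (fun k => (x k : ℝ)) k = m) →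
    (∃ k l, α k * β l - α l * β k ≠ 0) →
    (∀ i : Fin n, |α 0 * β i.succ - α i.succ * β 0| ≤ D * T ^ e₀) →
    (∀ i j : Fin n, |α i.succ * β j.succ - α j.succ * β i.succ| ≤ D * T ^ e₁) →
    ∃ x : Fin (n + 1) → ℤ, x ≠ 0 ∧
      |B.mulVec (fun k => (x k : ℝ)) 0| ≤ ((n : ℝ) + 1) ^ 2 * T ^ q₀ ∧
      ∀ i : Fin n, |B.mulVec (fun k => (x k : ℝ)) i.succ| ≤ ((n : ℝ) + 1) ^ 2 * T ^ q := by
  filter_upwards [eventually_gt_atTop 1, eventually_const_mul_rpow_lt D h₀,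
    eventually_const_mul_rpow_lt D h₁] with T hT hT₀ hT₁ α β hα hβ hne hm₀ hm₁
  have hT0 : 0 < T := by linarith
  have hq₀ := Real.rpow_pos_of_pos hT0 q₀
  have hq := Real.rpow_pos_of_pos hT0 q
  have hm₀' : ∀ i : Fin n, |α 0 * β i.succ - α i.succ * β 0| * T ^ q₀ * T ^ q
      < T ^ (q₀ + q * n) := by
    intro i
    have : T ^ (q₀ + q * n) = T ^ ((n - 1) * q) * T ^ q₀ * T ^ q := by
      rw [← Real.rpow_add hT0, ← Real.rpow_add hT0]; congr 1; ring
    rw [this]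
    gcongr
    exact (hm₀ i).trans_lt hT₀
  obtain ⟨x, hx0, hx⟩ := exists_int_of_two_forms B hB α β hα hβ hne
    (Fin.cons (T ^ q₀) fun _ => T ^ q)
    (fun k => by refine Fin.cases ?_ (fun i => ?_) k <;> simp [Real.rpow_pos_of_pos hT0])
    (by
      rw [Fin.prod_univ_succ]
      simp only [Fin.cons_zero, Fin.cons_succ, Finset.prod_const, Finset.card_univ,
        Fintype.card_fin]
      rw [← Real.rpow_mul_natCast hT0.le, ← Real.rpow_add hT0]
      refine fun k => Fin.cases (fun l => Fin.cases ?_ (fun j => ?_) l)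
        (fun i l => Fin.cases ?_ (fun j => ?_) l) k
      · exact fun h => absurd rfl h
      · intro _
        simpa using hm₀' j
      · intro _
        rw [abs_sub_comm, mul_right_comm, mul_comm (α i.succ)]
        simpa [mul_comm (α i.succ)] using hm₀' i
      · intro _
        have : T ^ (q₀ + q * n) = T ^ (q₀ + (n - 2) * q) * T ^ q * T ^ q := by
          rw [← Real.rpow_add hT0, ← Real.rpow_add hT0]; congr 1; ring
        rw [this, Fin.cons_succ, Fin.cons_succ]
        gcongr
        exact (hm₁ i j).trans_lt hT₁)
  refine ⟨x, hx0, ?_, fun i => ?_⟩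
  · simpa using hx 0
  · simpa using hx i.succ

/-! ### The two dual lattices attached to a vector -/

/-- The matrix sending the coefficients of a linear form `a₀ + ∑ aᵢ Tᵢ` to its value at `v`
followed by `a₁, …, aₙ`. -/
def formMatrix {n : ℕ} (v : Fin n → ℝ) : Matrix (Fin (n + 1)) (Fin (n + 1)) ℝ :=
  (1 : Matrix (Fin (n + 1)) (Fin (n + 1)) ℝ).updateRow 0 (Fin.cons 1 v)

/-- The matrix sending `(x, y₁, …, yₙ)` to `x` followed by the errors `yᵢ - vᵢ x`. It is the
inverse transpose of `formMatrix v`. -/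
def simMatrix {n : ℕ} (v : Fin n → ℝ) : Matrix (Fin (n + 1)) (Fin (n + 1)) ℝ :=
  ((1 : Matrix (Fin (n + 1)) (Fin (n + 1)) ℝ).updateRow 0 (Fin.cons 1 (-v))).transpose

theorem abs_det_formMatrix {n : ℕ} (v : Fin n → ℝ) : |(formMatrix v).det| = 1 := by
  rw [formMatrix, det_updateRow_one, Fin.cons_zero, abs_one]

theorem abs_det_simMatrix {n : ℕ} (v : Fin n → ℝ) : |(simMatrix v).det| = 1 := by
  rw [simMatrix, Matrix.det_transpose, det_updateRow_one, Fin.cons_zero, abs_one]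

theorem formMatrix_mulVec_zero {n : ℕ} (v : Fin n → ℝ) (z : Fin (n + 1) → ℝ) :
    (formMatrix v).mulVec z 0 = z 0 + ∑ i, z i.succ * v i := by
  rw [formMatrix, updateRow_mulVec_self, Fin.sum_univ_succ]
  simp [mul_comm]

theorem formMatrix_mulVec_succ {n : ℕ} (v : Fin n → ℝ) (z : Fin (n + 1) → ℝ) (i : Fin n) :
    (formMatrix v).mulVec z i.succ = z i.succ := by
  rw [formMatrix, updateRow_mulVec_of_ne _ (Fin.succ_ne_zero i), Matrix.one_mulVec]

theorem simMatrix_mulVec_zero {n : ℕ} (v : Fin n → ℝ) (z : Fin (n + 1) → ℝ) :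
    (simMatrix v).mulVec z 0 = z 0 := by
  simp [simMatrix, Matrix.mulVec, dotProduct, Fin.sum_univ_succ, Matrix.updateRow_apply]

theorem simMatrix_mulVec_succ {n : ℕ} (v : Fin n → ℝ) (z : Fin (n + 1) → ℝ) (i : Fin n) :
    (simMatrix v).mulVec z i.succ = z i.succ - v i * z 0 := by
  simp [simMatrix, Matrix.mulVec, dotProduct, Fin.sum_univ_succ, Matrix.updateRow_apply,
    Matrix.one_apply]
  ring

/-- An integer point `(x, y)` is an integer-valued linear form on the lattice of linear forms. -/
theorem sim_form_int {n : ℕ} (v : Fin n → ℝ) (x : ℤ) (y : Fin n → ℤ) (a : Fin (n + 1) → ℤ) :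
    ∃ m : ℤ, ∑ k, (Fin.cons (x : ℝ) (fun i => (y i : ℝ) - v i * x) : Fin (n + 1) → ℝ) k *
      (formMatrix v).mulVec (fun k => (a k : ℝ)) k = m := by
  refine ⟨x * a 0 + ∑ i, y i * a i.succ, ?_⟩
  rw [Fin.sum_univ_succ]
  simp only [Fin.cons_zero, Fin.cons_succ, formMatrix_mulVec_zero, formMatrix_mulVec_succ]
  push_cast
  rw [mul_add, add_assoc, Finset.mul_sum, ← Finset.sum_add_distrib]
  congr 1
  exact Finset.sum_congr rfl fun i _ => by ring

/-- A linear form with integer coefficients is an integer-valued linear form on the lattice of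
integer points. -/
theorem form_sim_int {n : ℕ} (v : Fin n → ℝ) (a₀ : ℤ) (a : Fin n → ℤ) (x : Fin (n + 1) → ℤ) :
    ∃ m : ℤ, ∑ k, (Fin.cons ((a₀ : ℝ) + ∑ i, (a i : ℝ) * v i) (fun i => (a i : ℝ)) :
      Fin (n + 1) → ℝ) k * (simMatrix v).mulVec (fun k => (x k : ℝ)) k = m := by
  refine ⟨a₀ * x 0 + ∑ i, a i * x i.succ, ?_⟩
  rw [Fin.sum_univ_succ]
  simp only [Fin.cons_zero, Fin.cons_succ, simMatrix_mulVec_zero, simMatrix_mulVec_succ]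
  push_cast
  rw [add_mul, add_assoc, Finset.sum_mul, ← Finset.sum_add_distrib]
  congr 1
  exact Finset.sum_congr rfl fun i _ => by ring

/-- There is a nonzero integer point `(x, y)` with `|x| ≤ Q` and errors at most `δ`. -/
def HasSimPoint {n : ℕ} (v : Fin n → ℝ) (Q δ : ℝ) : Prop :=
  ∃ (x : ℤ) (y : Fin n → ℤ), (x ≠ 0 ∨ y ≠ 0) ∧ |(x : ℝ)| ≤ Q ∧ ∀ i, |v i * x - y i| ≤ δ

/-- There is a nonzero integer linear form whose nonconstant coefficients are at most `H` and whose
value at `v` is at most `δ`. -/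
def HasForm {n : ℕ} (v : Fin n → ℝ) (H δ : ℝ) : Prop :=
  ∃ (a₀ : ℤ) (a : Fin n → ℤ), (a₀ ≠ 0 ∨ a ≠ 0) ∧ (∀ i, |(a i : ℝ)| ≤ H) ∧
    |(a₀ : ℝ) + ∑ i, (a i : ℝ) * v i| ≤ δ

/-- The numbers `1, v₁, …, vₙ` satisfy no nontrivial linear relation with integer coefficients. -/
def NoIntegerRelation {n : ℕ} (v : Fin n → ℝ) : Prop :=
  ∀ (a₀ : ℤ) (a : Fin n → ℤ), (a₀ : ℝ) + ∑ i, (a i : ℝ) * v i = 0 → a₀ = 0 ∧ a = 0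

theorem ne_zero_cases {n : ℕ} {x : Fin (n + 1) → ℤ} (hx : x ≠ 0) :
    x 0 ≠ 0 ∨ (fun i : Fin n => x i.succ) ≠ 0 := by
  by_contra! h
  refine hx (funext fun k => Fin.cases h.1 (fun i => ?_) k)
  exact congrFun h.2 i

theorem HasForm.of_formMatrix {n : ℕ} {v : Fin n → ℝ} {H δ : ℝ}
    (h : ∃ x : Fin (n + 1) → ℤ, x ≠ 0 ∧ |(formMatrix v).mulVec (fun k => (x k : ℝ)) 0| ≤ δ ∧
      ∀ i : Fin n, |(formMatrix v).mulVec (fun k => (x k : ℝ)) i.succ| ≤ H) : HasForm v H δ := by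
  obtain ⟨x, hx0, h0, h1⟩ := h
  rw [formMatrix_mulVec_zero] at h0
  simp only [formMatrix_mulVec_succ] at h1
  exact ⟨x 0, fun i => x i.succ, ne_zero_cases hx0, h1, h0⟩

theorem HasSimPoint.of_simMatrix {n : ℕ} {v : Fin n → ℝ} {Q δ : ℝ}
    (h : ∃ x : Fin (n + 1) → ℤ, x ≠ 0 ∧ |(simMatrix v).mulVec (fun k => (x k : ℝ)) 0| ≤ Q ∧
      ∀ i : Fin n, |(simMatrix v).mulVec (fun k => (x k : ℝ)) i.succ| ≤ δ) :
    HasSimPoint v Q δ := by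
  obtain ⟨x, hx0, h0, h1⟩ := h
  rw [simMatrix_mulVec_zero] at h0
  simp only [simMatrix_mulVec_succ] at h1
  exact ⟨x 0, fun i => x i.succ, ne_zero_cases hx0, h0, fun i => by rw [abs_sub_comm]; exact h1 i⟩

/-- Approximations that are good up to constants and with room in the exponents are solutions of
`SimSolvable`. -/
theorem eventually_simSolvable_of_hasSimPoint {n : ℕ} (v : Fin n → ℝ) (K : ℝ) {p r p' η : ℝ}
    (hp : p < p') (hr : η * p' < r) :
    ∀ᶠ T : ℝ in atTop, HasSimPoint v (K * T ^ p) (K * T ^ (-r)) → SimSolvable v η (T ^ p') := by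
  filter_upwards [eventually_gt_atTop 0, eventually_const_mul_rpow_lt K hp,
    eventually_const_mul_rpow_lt K (neg_lt_neg hr)] with T hT0 h0 h1
  rintro ⟨x, y, hne, hx, hy⟩
  refine ⟨x, y, hne, hx.trans h0.le, fun i => (hy i).trans ?_⟩
  rw [← Real.rpow_mul hT0.le, show p' * -η = -(η * p') by ring]
  exact h1.le

/-- The corresponding statement for linear forms; the constant coefficient is controlled by the
others and by the value of the form. -/
theorem eventually_formSolvable_of_hasForm {n : ℕ} {v : Fin n → ℝ}
    (hv : NoIntegerRelation v)
    (K : ℝ) {p r p' η : ℝ} (hp : p < p') (hr : η * p' < r) (hrp : -r < p') :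
    ∀ᶠ T : ℝ in atTop, HasForm v (K * T ^ p) (K * T ^ (-r)) → FormSolvable v η (T ^ p') := by
  set e := max p (-r) with he
  have hep : e < p' := max_lt hp hrp
  filter_upwards [eventually_ge_atTop 1, eventually_const_mul_rpow_lt K hp,
    eventually_const_mul_rpow_lt (|K| + ∑ i, |K| * |v i|) hep,
    eventually_const_mul_rpow_lt K (neg_lt_neg hr)] with T hT1 h0 h2 h1
  have hT0 : 0 < T := by linarith
  rintro ⟨a₀, a, hne, ha, hL⟩
  refine ⟨a₀, a, ⟨?_, fun i => (ha i).trans h0.le⟩, ?_, hL.trans ?_⟩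
  · refine le_trans ?_ h2.le
    have h3 : K * T ^ p ≤ |K| * T ^ e :=
      mul_le_mul (le_abs_self K) (Real.rpow_le_rpow_of_exponent_le hT1 (le_max_left _ _))
        (Real.rpow_nonneg hT0.le _) (abs_nonneg K)
    have h4 : K * T ^ (-r) ≤ |K| * T ^ e :=
      mul_le_mul (le_abs_self K) (Real.rpow_le_rpow_of_exponent_le hT1 (le_max_right _ _))
        (Real.rpow_nonneg hT0.le _) (abs_nonneg K)
    have h5 : |∑ i, (a i : ℝ) * v i| ≤ ∑ i, |K| * |v i| * T ^ e := by
      refine (Finset.abs_sum_le_sum_abs _ _).trans (Finset.sum_le_sum fun i _ => ?_)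
      rw [abs_mul]
      have := mul_le_mul_of_nonneg_right ((ha i).trans h3) (abs_nonneg (v i))
      linarith
    rw [← Finset.sum_mul] at h5
    have h6 : (a₀ : ℝ) = ((a₀ : ℝ) + ∑ i, (a i : ℝ) * v i) - ∑ i, (a i : ℝ) * v i := by ring
    rw [h6]
    refine (abs_sub _ _).trans ?_
    rw [add_mul]
    linarith
  · refine abs_pos.2 fun h => ?_
    obtain ⟨h, h'⟩ := hv _ _ h
    exact hne.elim (fun k => k h) (fun k => k h')
  · rw [← Real.rpow_mul hT0.le, show p' * -η = -(η * p') by ring]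
    exact h1.le

/-! ### Dirichlet's theorem and the transference of uniform exponents -/

/-- Dirichlet's theorem for simultaneous approximation. -/
theorem eventually_simSolvable_of_lt {n : ℕ} (v : Fin n → ℝ) {η : ℝ} (hn : 0 < n)
    (hη : η < 1 / n) : ∀ᶠ X : ℝ in atTop, SimSolvable v η X := by
  have hn' : (0 : ℝ) < n := by exact_mod_cast hn
  obtain ⟨r, hr, hrn⟩ := exists_between hη
  obtain ⟨p', hp', hrp⟩ : ∃ p' > (1 : ℝ), η * p' < r :=
    Eventually.exists_gt (((continuous_const_mul η).tendsto (1 : ℝ)).eventually_lt_const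
      (by simpa using hr))
  refine eventually_of_eventually_rpow (by linarith) ?_
  filter_upwards [eventually_gt_atTop 1, eventually_simSolvable_of_hasSimPoint v 1 hp' hrp]
    with T hT h
  refine h ?_
  rw [one_mul, one_mul]
  refine HasSimPoint.of_simMatrix (exists_int_box _ (abs_det_simMatrix v) hT ?_)
  rw [lt_div_iff₀ hn'] at hrn
  linarith

/-- Dirichlet's theorem for a linear form. -/
theorem eventually_formSolvable_of_lt {n : ℕ} {v : Fin n → ℝ}
    (hv : NoIntegerRelation v)
    {η : ℝ} (hη : η < n) : ∀ᶠ X : ℝ in atTop, FormSolvable v η X := by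
  obtain ⟨r, hr, hrn⟩ := exists_between (max_lt hη (by linarith [n.cast_nonneg (α := ℝ)] :
    (-1 : ℝ) < n))
  obtain ⟨hr, hr1⟩ := max_lt_iff.1 hr
  obtain ⟨p', hp', hrp⟩ : ∃ p' > (1 : ℝ), η * p' < r :=
    Eventually.exists_gt (((continuous_const_mul η).tendsto (1 : ℝ)).eventually_lt_const
      (by simpa using hr))
  refine eventually_of_eventually_rpow (by linarith) ?_
  filter_upwards [eventually_gt_atTop 1,
    eventually_formSolvable_of_hasForm hv 1 hp' hrp (by linarith)] with T hT h
  refine h ?_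
  rw [one_mul, one_mul]
  exact HasForm.of_formMatrix (exists_int_box _ (abs_det_formMatrix v) hT (by linarith))

/-- If `λ̂ > 1 / n` then `ŵ > n`. -/
theorem eventually_formSolvable_of_simSolvable {n : ℕ} {v : Fin n → ℝ} (hn : 0 < n)
    (hv : NoIntegerRelation v)
    {η : ℝ} (hη : 1 / n < η) (h : ∀ᶠ X : ℝ in atTop, SimSolvable v η X) :
    ∃ η' : ℝ, n < η' ∧ ∀ᶠ X : ℝ in atTop, FormSolvable v η' X := by
  have hn' : (0 : ℝ) < n := by exact_mod_cast hn
  have hn1 : (1 : ℝ) ≤ n := by exact_mod_cast hn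
  obtain ⟨r, hr1, hr⟩ : ∃ r, 1 < r ∧ r < η + (n - 1) * (1 / n) :=
    exists_between (by
      have : ((n : ℝ) - 1) * (1 / n) = 1 - 1 / n := by field_simp
      linarith)
  obtain ⟨p', hp', hpr⟩ : ∃ p', 1 / (n : ℝ) < p' ∧ p' < r / n :=
    exists_between (div_lt_div_of_pos_right hr1 hn')
  obtain ⟨p, hp, hpp⟩ := exists_between hp'
  have hp0 : 0 < p' := lt_trans (by positivity) hp'
  obtain ⟨η', hη', hηr⟩ : ∃ η', (n : ℝ) < η' ∧ η' < r / p' :=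
    exists_between (by
      rw [lt_div_iff₀ hn'] at hpr
      rw [lt_div_iff₀ hp0]; linarith)
  rw [lt_div_iff₀ hp0] at hηr
  refine ⟨η', hη', eventually_of_eventually_rpow hp0 ?_⟩
  filter_upwards [eventually_gt_atTop 1, h,
    eventually_formSolvable_of_hasForm hv (((n : ℝ) + 1) ^ 2) hpp hηr (by linarith)]
    with T hT ⟨x, y, hne, hx, hy⟩ hF
  refine hF (HasForm.of_formMatrix (exists_int_box_of_one_form (e₀ := 1) (e₁ := -η) _
    (abs_det_formMatrix v) hT ?_ ?_ _ (sim_form_int v x y) ?_ ?_ ?_))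
  · rw [div_lt_iff₀ hn'] at hp; linarith
  · have : ((n : ℝ) - 1) * (1 / n) ≤ (n - 1) * p :=
      mul_le_mul_of_nonneg_left hp.le (by linarith)
    linarith
  · intro h0
    have hx0 : (x : ℝ) = 0 := by simpa using congrFun h0 0
    refine hne.elim (fun h => h (by exact_mod_cast hx0)) (fun h => h (funext fun i => ?_))
    have := congrFun h0 i.succ
    simpa [hx0] using this
  · simpa using hx
  · intro i
    rw [Fin.cons_succ, abs_sub_comm]
    exact hy i

/-- If `ŵ > n` then `λ̂ > 1 / n`. -/
theorem eventually_simSolvable_of_formSolvable {n : ℕ} (v : Fin n → ℝ) (hn : 0 < n)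
    {η : ℝ} (hη : n < η) (h : ∀ᶠ X : ℝ in atTop, FormSolvable v η X) :
    ∃ η' : ℝ, 1 / n < η' ∧ ∀ᶠ X : ℝ in atTop, SimSolvable v η' X := by
  have hn' : (0 : ℝ) < n := by exact_mod_cast hn
  have hn1 : (1 : ℝ) ≤ n := by exact_mod_cast hn
  obtain ⟨r, hr1, hr⟩ : ∃ r, 1 < r ∧ r < η / n :=
    exists_between (by rw [lt_div_iff₀ hn']; linarith)
  rw [lt_div_iff₀ hn'] at hr
  obtain ⟨p, hp, hpr⟩ : ∃ p, 1 + (n - 1) * r < p ∧ p < n * r :=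
    exists_between (by linarith)
  obtain ⟨p', hpp, hpr'⟩ := exists_between hpr
  have hp0 : 0 < p' := by nlinarith
  obtain ⟨η', hη', hηr⟩ : ∃ η', 1 / (n : ℝ) < η' ∧ η' < r / p' :=
    exists_between (by
      rw [div_lt_div_iff₀ hn' hp0]; linarith)
  rw [lt_div_iff₀ hp0] at hηr
  refine ⟨η', hη', eventually_of_eventually_rpow hp0 ?_⟩
  filter_upwards [eventually_gt_atTop 1, h,
    eventually_simSolvable_of_hasSimPoint v (((n : ℝ) + 1) ^ 2) hpp hηr]
    with T hT ⟨a₀, a, ⟨_, ha⟩, hpos, hL⟩ hF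
  refine hF (HasSimPoint.of_simMatrix (exists_int_box_of_one_form (e₀ := -η) (e₁ := 1) _
    (abs_det_simMatrix v) hT ?_ ?_ _ (form_sim_int v a₀ a) ?_ ?_ ?_))
  · linarith
  · linarith
  · intro h0
    have := congrFun h0 0
    rw [Fin.cons_zero] at this
    rw [this] at hpos
    simp at hpos
  · exact hL
  · simpa using ha

/-! ### Transference through two consecutive best approximations -/

/-- Integer points with bounded `x` have errors bounded away from zero, so that better and better
approximations have `|x|` tending to infinity. -/
theorem exists_pos_le_error {n : ℕ} {v : Fin n → ℝ} (hn : 0 < n)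
    (hv : NoIntegerRelation v)
    (N : ℕ) : ∃ c : ℝ, 0 < c ∧ ∀ (x : ℤ) (y : Fin n → ℤ) (δ : ℝ), (x ≠ 0 ∨ y ≠ 0) →
      x.natAbs ≤ N → (∀ i, |v i * x - y i| ≤ δ) → c ≤ δ := by
  set i₀ : Fin n := ⟨0, hn⟩
  have hirr : ∀ x y : ℤ, x ≠ 0 → v i₀ * x - y ≠ 0 := by
    intro x y hx h
    obtain ⟨-, h2⟩ := hv (-y) (Pi.single i₀ x) (by
      rw [Finset.sum_eq_single i₀ (fun i _ hi => by simp [hi]) (by simp)]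
      simp; linarith)
    exact hx (by simpa using congrFun h2 i₀)
  set f : ℤ → ℝ := fun x => if x = 0 then 1 else |v i₀ * x - round (v i₀ * x)| with hf
  have hfpos : ∀ x, 0 < f x := by
    intro x
    by_cases hx : x = 0
    · simp [hf, hx]
    · simp only [hf, if_neg hx]
      exact abs_pos.2 (hirr x _ hx)
  obtain ⟨x₁, -, hx₁⟩ := Finset.exists_min_image (Finset.Icc (-(N : ℤ)) N) f ⟨0, by simp⟩
  refine ⟨f x₁, hfpos _, fun x y δ hne hxN hδ => ?_⟩
  refine (hx₁ x (by rw [Finset.mem_Icc]; omega)).trans ?_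
  by_cases hx : x = 0
  · simp only [hf, if_pos hx]
    obtain ⟨i, hi⟩ := Function.ne_iff.1 (hne.resolve_left (fun h => h hx))
    refine le_trans ?_ (hδ i)
    rw [hx, Int.cast_zero, mul_zero, zero_sub, abs_neg]
    exact_mod_cast Int.one_le_abs hi
  · simp only [hf, if_neg hx]
    exact (round_le _ _).trans (hδ i₀)

theorem abs_mul_sub_mul_le {a b c d A B C D : ℝ} (ha : |a| ≤ A) (hb : |b| ≤ B) (hc : |c| ≤ C)
    (hd : |d| ≤ D) : |a * b - c * d| ≤ A * B + C * D := by
  refine (abs_sub _ _).trans ?_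
  rw [abs_mul, abs_mul]
  exact add_le_add (mul_le_mul ha hb (abs_nonneg _) ((abs_nonneg _).trans ha))
    (mul_le_mul hc hd (abs_nonneg _) ((abs_nonneg _).trans hc))

/-- Linear forms orthogonal to two independent good simultaneous approximations, one of them of
ordinary quality `η` and size `T`, the other of uniform quality `η'` and size at most `T / 2`. -/
theorem frequently_hasForm_of_simSolvable {n : ℕ} {v : Fin n → ℝ} (hn : 0 < n)
    (hv : NoIntegerRelation v)
    {η' η p r : ℝ} (hη' : 0 < η') (hηη' : η' ≤ η)
    (hu : ∀ᶠ X : ℝ in atTop, SimSolvable v η' X) (ho : ∃ᶠ X : ℝ in atTop, SimSolvable v η X)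
    (hp : 1 - η' < (n - 1) * p) (hr : r < η + η' + (n - 2) * p) :
    ∃ᶠ T : ℝ in atTop, HasForm v (((n : ℝ) + 1) ^ 2 * T ^ p) (((n : ℝ) + 1) ^ 2 * T ^ (-r)) := by
  have hη : 0 < η := hη'.trans_le hηη'
  set D : ℝ := 2 * 2 ^ η' + 1 with hD
  have htwo := exists_int_box_of_two_forms (formMatrix v) (abs_det_formMatrix v) D
    (q₀ := -r) (q := p) (e₀ := 1 - η') (e₁ := -η - η') hp (by linarith)
  have hu2 : ∀ᶠ T : ℝ in atTop, SimSolvable v η' (T / 2) :=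
    (tendsto_id.atTop_div_const two_pos).eventually hu
  obtain ⟨M₀, hM₀⟩ := eventually_atTop.1 ((htwo.and hu2).and (eventually_ge_atTop (1 : ℝ)))
  refine frequently_atTop.2 fun M => ?_
  obtain ⟨N, hN⟩ := exists_nat_ge (max M M₀)
  obtain ⟨c, hc, hcN⟩ := exists_pos_le_error hn hv N
  have hsmall : ∀ᶠ X : ℝ in atTop, X ^ (-η) < c :=
    (tendsto_rpow_neg_atTop hη).eventually_lt_const hc
  obtain ⟨X, ⟨x, y, hne, hxX, hyX⟩, hXc, hX0⟩ :=
    (ho.and_eventually (hsmall.and (eventually_gt_atTop 0))).exists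
  -- a point with least `|x|` among those with error at most `X ^ (-η)`
  have hex : ∃ m : ℕ, ∃ (x : ℤ) (y : Fin n → ℤ), (x ≠ 0 ∨ y ≠ 0) ∧ x.natAbs = m ∧
      ∀ i, |v i * x - y i| ≤ X ^ (-η) := ⟨_, x, y, hne, rfl, hyX⟩
  classical
  obtain ⟨x₁, y₁, hne₁, hx₁, hy₁⟩ := Nat.find_spec hex
  have hmin : ∀ (x₂ : ℤ) (y₂ : Fin n → ℤ), (x₂ ≠ 0 ∨ y₂ ≠ 0) →
      (∀ i, |v i * x₂ - y₂ i| ≤ X ^ (-η)) → |(x₁ : ℝ)| ≤ |(x₂ : ℝ)| := by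
    intro x₂ y₂ h h'
    have h1 : x₁.natAbs ≤ x₂.natAbs := hx₁ ▸ Nat.find_min' hex ⟨x₂, y₂, h, rfl, h'⟩
    rw [← Int.cast_abs, ← Int.cast_abs, Int.cast_le, Int.abs_eq_natAbs, Int.abs_eq_natAbs]
    exact_mod_cast h1
  set T : ℝ := |(x₁ : ℝ)| with hT
  have hTN : (N : ℝ) ≤ T := by
    have h1 : N < x₁.natAbs := by
      by_contra! h
      exact absurd (hcN x₁ y₁ _ hne₁ h hy₁) (not_le.2 hXc)
    rw [hT, ← Int.cast_abs]
    have : (N : ℤ) ≤ |x₁| := by rw [Int.abs_eq_natAbs]; exact_mod_cast h1.le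
    exact_mod_cast this
  have hTX : T ≤ X := (hmin x y hne hyX).trans hxX
  have hTM : M ≤ T := (le_max_left _ _).trans (hN.trans hTN)
  obtain ⟨⟨htwo, x₂, y₂, hne₂, hx₂, hy₂⟩, hT1⟩ := hM₀ T ((le_max_right _ _).trans (hN.trans hTN))
  have hT0 : 0 < T := by linarith
  refine ⟨T, hTM, HasForm.of_formMatrix (htwo _ _ (sim_form_int v x₁ y₁) (sim_form_int v x₂ y₂)
    ?_ ?_ ?_)⟩
  -- If the points were dependent, the second one would be the first one times a number of absolute
  -- value at most `1 / 2`, against the minimality of the first.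
  · by_contra! h
    have h1 : ∀ i, |v i * x₂ - y₂ i| ≤ X ^ (-η) := by
      intro i
      have h2 := h 0 i.succ
      simp only [Fin.cons_zero, Fin.cons_succ] at h2
      have h3 : T * |v i * x₂ - y₂ i| = |v i * x₁ - y₁ i| * |(x₂ : ℝ)| := by
        rw [hT, ← abs_mul, ← abs_mul]
        congr 1
        linarith
      refine le_trans ?_ (hy₁ i)
      refine le_of_mul_le_mul_left ?_ hT0
      rw [h3, mul_comm]
      exact mul_le_mul_of_nonneg_right (by linarith) (abs_nonneg _)
    have := hmin x₂ y₂ hne₂ h1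
    linarith
  all_goals
    have hy₁' : ∀ i, |(y₁ i : ℝ) - v i * x₁| ≤ T ^ (-η) := fun i => by
      rw [abs_sub_comm]
      exact (hy₁ i).trans (Real.rpow_le_rpow_of_nonpos hT0 hTX (by linarith))
    have hy₂' : ∀ i, |(y₂ i : ℝ) - v i * x₂| ≤ 2 ^ η' * T ^ (-η') := fun i => by
      rw [abs_sub_comm]
      refine (hy₂ i).trans (le_of_eq ?_)
      rw [Real.div_rpow hT0.le two_pos.le, Real.rpow_neg two_pos.le, div_inv_eq_mul, mul_comm]
    have h2 : (0 : ℝ) < 2 ^ η' := Real.rpow_pos_of_pos two_pos _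
  · intro i
    simp only [Fin.cons_zero, Fin.cons_succ]
    refine (abs_mul_sub_mul_le le_rfl (hy₂' i) (hy₁' i) (hx₂.trans (half_le_self hT0.le))).trans ?_
    have h3 : T ^ (-η) ≤ T ^ (-η') := Real.rpow_le_rpow_of_exponent_le hT1 (by linarith)
    have h4 : T ^ (1 - η') = T * T ^ (-η') := by
      rw [sub_eq_add_neg, Real.rpow_add hT0, Real.rpow_one]
    have h5 : T ^ (-η) * T ≤ T ^ (1 - η') := by
      rw [h4, mul_comm]; exact mul_le_mul_of_nonneg_left h3 hT0.le
    have h6 : 0 < T ^ (1 - η') := Real.rpow_pos_of_pos hT0 _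
    rw [← hT, show T * (2 ^ η' * T ^ (-η')) = 2 ^ η' * T ^ (1 - η') by rw [h4]; ring, hD]
    nlinarith
  · intro i j
    simp only [Fin.cons_succ]
    refine (abs_mul_sub_mul_le (hy₁' i) (hy₂' j) (hy₁' j) (hy₂' i)).trans ?_
    have h4 : T ^ (-η - η') = T ^ (-η) * T ^ (-η') := by
      rw [sub_eq_add_neg, Real.rpow_add hT0]
    have h6 : 0 < T ^ (-η - η') := Real.rpow_pos_of_pos hT0 _
    rw [show T ^ (-η) * (2 ^ η' * T ^ (-η')) = 2 ^ η' * T ^ (-η - η') by rw [h4]; ring, hD]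
    nlinarith

/-- Integer points orthogonal to two independent linear forms with small values. One has value
`1 / S` and ordinary quality `η`, so its height is at most `S ^ (1 / η)`. The other has a value
at most half as large and uniform quality `η'`, so its height is of order at most `S ^ (1 / η')`. -/
theorem frequently_hasSimPoint_of_formSolvable {n : ℕ} {v : Fin n → ℝ}
    {η' η p r : ℝ} (hη' : 1 ≤ η') (hηη' : η' ≤ η)
    (hu : ∀ᶠ X : ℝ in atTop, FormSolvable v η' X) (ho : ∃ᶠ X : ℝ in atTop, FormSolvable v η X)
    (hr : (n - 1) * r < 1 - 1 / η') (hp : 1 / η + 1 / η' + (n - 2) * r < p) :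
    ∃ᶠ S : ℝ in atTop,
      HasSimPoint v (((n : ℝ) + 1) ^ 2 * S ^ p) (((n : ℝ) + 1) ^ 2 * S ^ (-r)) := by
  have hη'0 : 0 < η' := by linarith
  have hη : 0 < η := by linarith
  set D : ℝ := 2 * 2 ^ (1 / η') + 1 with hD
  have htwo := exists_int_box_of_two_forms (simMatrix v) (abs_det_simMatrix v) D
    (q₀ := p) (q := -r) (e₀ := -1 + 1 / η') (e₁ := 1 / η + 1 / η') (by linarith) (by linarith)
  have hu2 : ∀ᶠ S : ℝ in atTop, FormSolvable v η' ((2 * S) ^ (1 / η')) :=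
    ((tendsto_rpow_atTop (by positivity)).comp (tendsto_id.const_mul_atTop two_pos)).eventually hu
  obtain ⟨M₀, hM₀⟩ := eventually_atTop.1 (htwo.and hu2)
  refine frequently_atTop.2 fun M => ?_
  obtain ⟨X, ⟨a₀, a, ⟨-, haX⟩, hLpos, hLX⟩, hXM, hX1⟩ :=
    (ho.and_eventually ((eventually_ge_atTop (max M M₀)).and (eventually_gt_atTop 1))).exists
  have hX0 : 0 < X := by linarith
  -- a form of least height among those with value at most `X ^ (-η)`
  have hex : ∃ m : ℕ, ∃ (a₀ : ℤ) (a : Fin n → ℤ), (∀ i, |a i| ≤ m) ∧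
      0 < |(a₀ : ℝ) + ∑ i, (a i : ℝ) * v i| ∧
      |(a₀ : ℝ) + ∑ i, (a i : ℝ) * v i| ≤ X ^ (-η) := by
    refine ⟨⌊X⌋₊, a₀, a, fun i => ?_, hLpos, hLX⟩
    have h1 : ((a i).natAbs : ℝ) ≤ X := by
      rw [Nat.cast_natAbs, Int.cast_abs]; exact haX i
    rw [Int.abs_eq_natAbs]
    exact_mod_cast Nat.le_floor h1
  classical
  obtain ⟨b₀, b, hb, hb0, hbX⟩ := Nat.find_spec hex
  have hmin : ∀ (m : ℕ) (c₀ : ℤ) (c : Fin n → ℤ), (∀ i, |c i| ≤ m) →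
      0 < |(c₀ : ℝ) + ∑ i, (c i : ℝ) * v i| →
      |(c₀ : ℝ) + ∑ i, (c i : ℝ) * v i| ≤ X ^ (-η) → Nat.find hex ≤ m :=
    fun m c₀ c h h' h'' => Nat.find_min' hex ⟨c₀, c, h, h', h''⟩
  set m := Nat.find hex
  set L := (b₀ : ℝ) + ∑ i, (b i : ℝ) * v i with hL
  set S : ℝ := |L|⁻¹ with hS
  have hS0 : 0 < S := inv_pos.2 hb0
  have hLS : |L| = S⁻¹ := by rw [hS, inv_inv]
  have hXS : X ^ η ≤ S := by
    rw [hLS, Real.rpow_neg hX0.le] at hbX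
    exact (inv_le_inv₀ hS0 (Real.rpow_pos_of_pos hX0 _)).1 hbX
  have hXS' : X ≤ S := by
    refine le_trans ?_ hXS
    calc X = X ^ (1 : ℝ) := (Real.rpow_one X).symm
      _ ≤ X ^ η := Real.rpow_le_rpow_of_exponent_le hX1.le (by linarith)
  have hS1 : 1 ≤ S := by linarith
  have hXS'' : X ≤ S ^ (1 / η) := by
    calc X = (X ^ η) ^ (1 / η) := by
          rw [← Real.rpow_mul hX0.le, mul_one_div_cancel hη.ne', Real.rpow_one]
      _ ≤ S ^ (1 / η) := Real.rpow_le_rpow (Real.rpow_nonneg hX0.le _) hXS (by positivity)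
  have hmX : (m : ℝ) ≤ X := by
    have h1 : m ≤ ⌊X⌋₊ := hmin _ a₀ a (fun i => by
      have h1 : ((a i).natAbs : ℝ) ≤ X := by
        rw [Nat.cast_natAbs, Int.cast_abs]; exact haX i
      rw [Int.abs_eq_natAbs]
      exact_mod_cast Nat.le_floor h1) hLpos hLX
    exact (Nat.cast_le.2 h1).trans (Nat.floor_le hX0.le)
  have hbm : ∀ i, |(b i : ℝ)| ≤ m := fun i => by
    rw [← Int.cast_abs]; exact_mod_cast hb i
  obtain ⟨htwo, c₀, c, ⟨-, hc⟩, hc0, hcX⟩ :=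
    hM₀ S (((le_max_right _ _).trans hXM).trans hXS')
  -- The height bound `Y = (2 * S) ^ (1 / η')` of the second form is such that
  -- `Y ^ (-η') = 1 / (2 * S)`.
  have hcL : |(c₀ : ℝ) + ∑ i, (c i : ℝ) * v i| ≤ |L| / 2 := by
    refine hcX.trans (le_of_eq ?_)
    rw [← Real.rpow_mul (by positivity), show 1 / η' * -η' = -1 by field_simp,
      Real.rpow_neg_one, hLS, mul_inv]
    ring
  refine ⟨S, ((le_max_left _ _).trans hXM).trans hXS', HasSimPoint.of_simMatrix
    (htwo _ _ (form_sim_int v b₀ b) (form_sim_int v c₀ c) ?_ ?_ ?_)⟩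
  -- If the forms were dependent, the second one would be the first one times a number of absolute
  -- value at most `1 / 2`, against the minimality of the first.
  · by_contra! h
    have h1 : ∀ i, |(c i : ℝ)| ≤ |(b i : ℝ)| / 2 := by
      intro i
      have h2 := h 0 i.succ
      simp only [Fin.cons_zero, Fin.cons_succ, ← hL] at h2
      have h3 : |L| * |(c i : ℝ)| = |(b i : ℝ)| * |(c₀ : ℝ) + ∑ i, (c i : ℝ) * v i| := by
        rw [← abs_mul, ← abs_mul]
        congr 1
        linarith
      refine le_of_mul_le_mul_left ?_ hb0
      rw [h3]
      have := mul_le_mul_of_nonneg_left hcL (abs_nonneg (b i : ℝ))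
      linarith
    have h2 : m ≤ m / 2 := by
      refine hmin _ c₀ c (fun i => ?_) hc0 (hcL.trans (by linarith))
      have h3 : 2 * |(c i : ℝ)| ≤ m := by linarith [h1 i, hbm i]
      rw [← Int.cast_abs] at h3
      have h4 : 2 * |c i| ≤ m := by exact_mod_cast h3
      omega
    have hm0 : m = 0 := by omega
    have hb00 : ∀ i, b i = 0 := fun i => by
      have := hb i
      rw [hm0] at this
      exact abs_eq_zero.1 (le_antisymm (by simpa using this) (abs_nonneg _))
    have hLb : L = b₀ := by simp [hL, hb00]
    have h5 : |L| < 1 := hbX.trans_lt (Real.rpow_lt_one_of_one_lt_of_neg hX1 (by linarith))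
    rw [eq_zero_of_abs_lt_one_of_int ⟨b₀, hLb⟩ h5] at hb0
    simp at hb0
  all_goals
    have hbS : ∀ i, |(b i : ℝ)| ≤ S ^ (1 / η) := fun i => ((hbm i).trans hmX).trans hXS''
    have hcS : ∀ i, |(c i : ℝ)| ≤ 2 ^ (1 / η') * S ^ (1 / η') := fun i =>
      (hc i).trans (le_of_eq (Real.mul_rpow two_pos.le hS0.le))
    have h2 : (0 : ℝ) < 2 ^ (1 / η') := Real.rpow_pos_of_pos two_pos _
  · intro i
    simp only [Fin.cons_zero, Fin.cons_succ]
    refine (abs_mul_sub_mul_le le_rfl (hcS i) (hbS i)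
      (hcL.trans (half_le_self (abs_nonneg _)))).trans ?_
    have h3 : S ^ (1 / η) ≤ S ^ (1 / η') :=
      Real.rpow_le_rpow_of_exponent_le hS1 (one_div_le_one_div_of_le hη'0 hηη')
    have h4 : S ^ (-1 + 1 / η') = S⁻¹ * S ^ (1 / η') := by
      rw [Real.rpow_add hS0, Real.rpow_neg_one]
    have h5 : S ^ (1 / η) * S⁻¹ ≤ S ^ (-1 + 1 / η') := by
      rw [h4, mul_comm]; exact mul_le_mul_of_nonneg_left h3 (inv_pos.2 hS0).le
    have h6 : 0 < S ^ (-1 + 1 / η') := Real.rpow_pos_of_pos hS0 _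
    rw [← hL, hLS, show S⁻¹ * (2 ^ (1 / η') * S ^ (1 / η')) = 2 ^ (1 / η') * S ^ (-1 + 1 / η') by
      rw [h4]; ring, hD]
    nlinarith
  · intro i j
    simp only [Fin.cons_succ]
    refine (abs_mul_sub_mul_le (hbS i) (hcS j) (hbS j) (hcS i)).trans ?_
    have h4 : S ^ (1 / η + 1 / η') = S ^ (1 / η) * S ^ (1 / η') := Real.rpow_add hS0 _ _
    have h6 : 0 < S ^ (1 / η + 1 / η') := Real.rpow_pos_of_pos hS0 _
    rw [show S ^ (1 / η) * (2 ^ (1 / η') * S ^ (1 / η')) = 2 ^ (1 / η') * S ^ (1 / η + 1 / η') by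
      rw [h4]; ring, hD]
    nlinarith

/-! ### From solvability to exponents -/

theorem lt_expSup_iff {S : Set ℝ} {a : EReal} : a < expSup S ↔ ∃ η ∈ S, a < (η : EReal) := by
  rw [expSup, lt_sSup_iff]
  exact Set.exists_mem_image

theorem le_expSup {S : Set ℝ} {η : ℝ} (h : η ∈ S) : (η : EReal) ≤ expSup S :=
  le_sSup (Set.mem_image_of_mem _ h)

theorem SimSolvable.mono {n : ℕ} {v : Fin n → ℝ} {η η' X : ℝ} (hX : 1 ≤ X) (hη : η' ≤ η)
    (h : SimSolvable v η X) : SimSolvable v η' X := by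
  obtain ⟨x, y, hne, hx, hy⟩ := h
  exact ⟨x, y, hne, hx, fun i =>
    (hy i).trans (Real.rpow_le_rpow_of_exponent_le hX (neg_le_neg hη))⟩

theorem FormSolvable.mono {n : ℕ} {v : Fin n → ℝ} {η η' X : ℝ} (hX : 1 ≤ X) (hη : η' ≤ η)
    (h : FormSolvable v η X) : FormSolvable v η' X := by
  obtain ⟨a₀, a, ha, hpos, hL⟩ := h
  exact ⟨a₀, a, ha, hpos, hL.trans (Real.rpow_le_rpow_of_exponent_le hX (neg_le_neg hη))⟩

theorem frequently_simSolvable_of_lt_lamVec {n : ℕ} {v : Fin n → ℝ} {η : ℝ}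
    (h : (η : EReal) < lamVec v) : ∃ᶠ X : ℝ in atTop, SimSolvable v η X := by
  obtain ⟨η₁, h₁, hlt⟩ := lt_expSup_iff.1 h
  exact (h₁.and_eventually (eventually_ge_atTop 1)).mono fun X hX =>
    hX.1.mono hX.2 (EReal.coe_lt_coe_iff.1 hlt).le

theorem frequently_formSolvable_of_lt_wVec {n : ℕ} {v : Fin n → ℝ} {η : ℝ}
    (h : (η : EReal) < wVec v) : ∃ᶠ X : ℝ in atTop, FormSolvable v η X := by
  obtain ⟨η₁, h₁, hlt⟩ := lt_expSup_iff.1 h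
  exact (h₁.and_eventually (eventually_ge_atTop 1)).mono fun X hX =>
    hX.1.mono hX.2 (EReal.coe_lt_coe_iff.1 hlt).le

theorem eventually_simSolvable_of_lt_lamHatVec {n : ℕ} {v : Fin n → ℝ} {η : ℝ}
    (h : (η : EReal) < lamHatVec v) : ∀ᶠ X : ℝ in atTop, SimSolvable v η X := by
  obtain ⟨η₁, h₁, hlt⟩ := lt_expSup_iff.1 h
  filter_upwards [show ∀ᶠ X : ℝ in atTop, SimSolvable v η₁ X from h₁, eventually_ge_atTop 1]
    with X hX hX1
  exact hX.mono hX1 (EReal.coe_lt_coe_iff.1 hlt).le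

theorem eventually_formSolvable_of_lt_wHatVec {n : ℕ} {v : Fin n → ℝ} {η : ℝ}
    (h : (η : EReal) < wHatVec v) : ∀ᶠ X : ℝ in atTop, FormSolvable v η X := by
  obtain ⟨η₁, h₁, hlt⟩ := lt_expSup_iff.1 h
  filter_upwards [show ∀ᶠ X : ℝ in atTop, FormSolvable v η₁ X from h₁, eventually_ge_atTop 1]
    with X hX hX1
  exact hX.mono hX1 (EReal.coe_lt_coe_iff.1 hlt).le

theorem lamHatVec_le_lamVec {n : ℕ} (v : Fin n → ℝ) : lamHatVec v ≤ lamVec v :=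
  sSup_le_sSup (Set.image_mono fun _ h => Eventually.frequently h)

theorem wHatVec_le_wVec {n : ℕ} (v : Fin n → ℝ) : wHatVec v ≤ wVec v :=
  sSup_le_sSup (Set.image_mono fun _ h => Eventually.frequently h)

theorem one_div_le_lamHatVec {n : ℕ} (v : Fin n → ℝ) (hn : 0 < n) :
    ((1 / (n : ℝ) : ℝ) : EReal) ≤ lamHatVec v :=
  EReal.ge_of_forall_gt_iff_ge.1 fun _ hη =>
    le_expSup (eventually_simSolvable_of_lt v hn (EReal.coe_lt_coe_iff.1 hη))

theorem le_wHatVec {n : ℕ} {v : Fin n → ℝ}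
    (hv : NoIntegerRelation v) :
    ((n : ℝ) : EReal) ≤ wHatVec v :=
  EReal.ge_of_forall_gt_iff_ge.1 fun _ hη =>
    le_expSup (eventually_formSolvable_of_lt hv (EReal.coe_lt_coe_iff.1 hη))

theorem lamHatVec_le_of_wHatVec_le {n : ℕ} {v : Fin n → ℝ} (hn : 0 < n)
    (hv : NoIntegerRelation v)
    (h : wHatVec v ≤ ((n : ℝ) : EReal)) : lamHatVec v ≤ ((1 / (n : ℝ) : ℝ) : EReal) := by
  by_contra! hlt
  obtain ⟨η, hη, hlt⟩ := lt_expSup_iff.1 hlt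
  obtain ⟨η', hη', h'⟩ :=
    eventually_formSolvable_of_simSolvable hn hv (EReal.coe_lt_coe_iff.1 hlt) hη
  exact absurd ((le_expSup h').trans h) (not_le.2 (EReal.coe_lt_coe_iff.2 hη'))

theorem wHatVec_le_of_lamHatVec_le {n : ℕ} {v : Fin n → ℝ} (hn : 0 < n)
    (h : lamHatVec v ≤ ((1 / (n : ℝ) : ℝ) : EReal)) : wHatVec v ≤ ((n : ℝ) : EReal) := by
  by_contra! hlt
  obtain ⟨η, hη, hlt⟩ := lt_expSup_iff.1 hlt
  obtain ⟨η', hη', h'⟩ :=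
    eventually_simSolvable_of_formSolvable v hn (EReal.coe_lt_coe_iff.1 hlt) hη
  exact absurd ((le_expSup h').trans h) (not_le.2 (EReal.coe_lt_coe_iff.2 hη'))

/-! ### Strictness of Khintchine's inequalities -/

/-- For `n = 1` the uniform exponent is never larger than one. -/
theorem lamHatVec_le_of_eq_one {n : ℕ} {v : Fin n → ℝ} (hn : n = 1)
    (hv : NoIntegerRelation v) :
    lamHatVec v ≤ ((1 / (n : ℝ) : ℝ) : EReal) := by
  by_contra! hlt
  obtain ⟨η, hη, hlt⟩ := lt_expSup_iff.1 hlt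
  have hη1 : (1 : ℝ) < η := by simpa [hn] using EReal.coe_lt_coe_iff.1 hlt
  have hn' : (n : ℝ) = 1 := by exact_mod_cast hn
  have hfreq := frequently_hasForm_of_simSolvable (η := η) (η' := η) (p := -1) (r := 1)
    (by omega) hv (by linarith) le_rfl hη (Eventually.frequently hη) (by rw [hn']; linarith)
    (by rw [hn']; linarith)
  obtain ⟨T, hT, hrob, hT1⟩ := (hfreq.and_eventually
    ((eventually_formSolvable_of_hasForm hv (((n : ℝ) + 1) ^ 2) (p := -1) (r := 1)
      (p' := -1 / 2) (η := 0) (by norm_num) (by norm_num) (by norm_num)).and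
      (eventually_gt_atTop 1))).exists
  -- For `n = 1` no form is orthogonal to two independent points. Accordingly the exponents may be
  -- negative: the form obtained here has height at most `T ^ (-1 / 2) < 1`.
  obtain ⟨a₀, a, ⟨ha₀, ha⟩, hpos, -⟩ := hrob hT
  have hlt1 : T ^ (-1 / 2 : ℝ) < 1 := Real.rpow_lt_one_of_one_lt_of_neg hT1 (by norm_num)
  have h0 : (a₀ : ℝ) = 0 := eq_zero_of_abs_lt_one_of_int ⟨a₀, rfl⟩ (ha₀.trans_lt hlt1)
  have h1 : ∀ i, (a i : ℝ) = 0 := fun i =>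
    eq_zero_of_abs_lt_one_of_int ⟨a i, rfl⟩ ((ha i).trans_lt hlt1)
  simp [h0, h1] at hpos

/-- The upper Khintchine inequality is strict if `λ̂ > 1 / n` and `λ < ∞`. -/
theorem not_khintchineRightEq {n : ℕ} {v : Fin n → ℝ} (hn : 0 < n)
    (hv : NoIntegerRelation v)
    (hlt : ((1 / (n : ℝ) : ℝ) : EReal) < lamHatVec v) (htop : lamVec v ≠ ⊤) :
    ¬ KhintchineRightEq n (lamVec v) (wVec v) := by
  have hn' : (0 : ℝ) < n := by exact_mod_cast hn
  have hn1 : (1 : ℝ) ≤ n := by exact_mod_cast hn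
  obtain ⟨η', hη', hη'lt⟩ := EReal.lt_iff_exists_real_btwn.1 hlt
  have hη'l : (η' : EReal) < lamVec v := hη'lt.trans_le (lamHatVec_le_lamVec v)
  obtain ⟨l, hl⟩ : ∃ l : ℝ, lamVec v = l :=
    ⟨(lamVec v).toReal, (EReal.coe_toReal htop (ne_bot_of_gt hη'l)).symm⟩
  rw [hl, EReal.coe_lt_coe_iff] at hη'l
  rw [EReal.coe_lt_coe_iff] at hη'
  intro heq
  have hw : wVec v = ((n * l + n - 1 : ℝ) : EReal) := by
    rw [← show (n : EReal) * lamVec v + n - 1 = wVec v from heq, hl]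
    push_cast
    rfl
  have hη'0 : 0 < η' := lt_trans (by positivity) hη'
  have hcont : ∀ᶠ p : ℝ in nhds (1 / n), 0 < p ∧ 1 - η' < (n - 1) * p := by
    refine (lt_mem_nhds (by positivity)).and
      (((continuous_const_mul _).tendsto _).eventually_const_lt ?_)
    have : ((n : ℝ) - 1) * (1 / n) = 1 - 1 / n := by field_simp
    linarith
  obtain ⟨p', hp'n, hp'0, hp'⟩ := hcont.exists_lt
  obtain ⟨p, hpp', hp⟩ : ∃ p < p', 1 - η' < (n - 1) * p :=
    ((((continuous_const_mul _).tendsto p').eventually_const_lt hp')).exists_lt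
  rw [lt_div_iff₀ hn'] at hp'n
  obtain ⟨η₁, hη₁, hη₁'⟩ : ∃ η₁, n * l + n - 1 < η₁ ∧ η₁ < (l + 1) / p' - 1 :=
    exists_between (by
      have : (n : ℝ) * (l + 1) < (l + 1) / p' := by
        rw [lt_div_iff₀ hp'0]; nlinarith
      linarith)
  have hη₁p : η₁ * p' < l + 1 - p' := by
    have := mul_lt_mul_of_pos_right hη₁' hp'0
    rwa [sub_mul, div_mul_cancel₀ _ hp'0.ne', one_mul] at this
  obtain ⟨η, hη, hηl⟩ : ∃ η, max η' (η₁ * p' - 1 + p) < η ∧ η < l :=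
    exists_between (max_lt hη'l (by linarith))
  obtain ⟨hηη', hηp⟩ := max_lt_iff.1 hη
  have hp1 : p' < 1 := by nlinarith
  -- Here `p < p' < 1 / n`, whereas Khintchine's argument, which uses one point only, has
  -- `p = 1 / n`; the value of the form is `T ^ (-r)` with `r = η + 1 - p` in both cases.
  have hfreq := frequently_hasForm_of_simSolvable (r := η + 1 - p) hn hv hη'0 hηη'.le
    (eventually_simSolvable_of_lt_lamHatVec hη'lt)
    (frequently_simSolvable_of_lt_lamVec (by rw [hl]; exact EReal.coe_lt_coe_iff.2 hηl))
    hp (by linarith)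
  have hF : ∃ᶠ X : ℝ in atTop, FormSolvable v η₁ X :=
    frequently_of_frequently_rpow hp'0 ((hfreq.and_eventually
      (eventually_formSolvable_of_hasForm hv (((n : ℝ) + 1) ^ 2) hpp'
        (r := η + 1 - p) (η := η₁) (by linarith) (by linarith))).mono fun T hT => hT.2 hT.1)
  have hle : (η₁ : EReal) ≤ wVec v := le_expSup hF
  rw [hw, EReal.coe_le_coe_iff] at hle
  linarith

/-- The lower Khintchine bound for an ordinary exponent `w = 1 / s` is the solution `l` of
`l * (s + 1 - 1 / n) = 1 / n`. It is exceeded strictly as soon as `ŵ > n`. -/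
theorem lt_lamVec_of_lt_wHatVec {n : ℕ} {v : Fin n → ℝ} (hn : 2 ≤ n) {η' s l : ℝ}
    (hη' : n < η') (hη'lt : (η' : EReal) < wHatVec v) (hs : 0 ≤ s)
    (hw : ∀ s' > s, ∃ η : ℝ, η' ≤ η ∧ (η : EReal) < wVec v ∧ 1 / η < s')
    (hl : l * (s + 1 - 1 / n) = 1 / n) : (l : EReal) < lamVec v := by
  have hn2 : (2 : ℝ) ≤ n := by exact_mod_cast hn
  have hn' : (0 : ℝ) < n := by linarith
  have hinv : 1 / (n : ℝ) ≤ 1 / 2 := one_div_le_one_div_of_le two_pos hn2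
  have hinv0 : 0 < 1 / (n : ℝ) := by positivity
  have hl0 : 0 < l := by
    by_contra! h
    have := mul_nonneg_of_nonpos_of_nonpos h (b := -(s + 1 - 1 / n)) (by linarith)
    linarith
  obtain ⟨r, hrn, hr⟩ : ∃ r > 1 / (n : ℝ), (n - 1) * r < 1 - 1 / η' :=
    (((continuous_const_mul _).tendsto _).eventually_lt_const (by
      have h1 : ((n : ℝ) - 1) * (1 / n) = 1 - 1 / n := by field_simp
      have h2 : 1 / η' < 1 / n := one_div_lt_one_div_of_lt hn' hη'
      linarith)).exists_gt
  have hη'inv : 0 < 1 / η' := by have := hn'.trans hη'; positivity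
  have hr1 : r < 1 := by nlinarith
  obtain ⟨p', hp', hlp'⟩ : ∃ p' > s + 1 - r, l * p' < r :=
    (((continuous_const_mul _).tendsto _).eventually_lt_const (by nlinarith)).exists_gt
  obtain ⟨η₁, hη₁, hη₁p⟩ : ∃ η₁ > l, η₁ * p' < r :=
    (((continuous_mul_const _).tendsto _).eventually_lt_const hlp').exists_gt
  obtain ⟨η, hη, hηw, hηs⟩ := hw (p' - 1 + r) (by linarith)
  -- Here `r > 1 / n`, whereas Khintchine's argument, which uses one form only, has `r = 1 / n`.
  have hfreq := frequently_hasSimPoint_of_formSolvable (v := v) (r := r) (p := 1 / η + 1 - r)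
    (by linarith) hη (eventually_formSolvable_of_lt_wHatVec hη'lt)
    (frequently_formSolvable_of_lt_wVec hηw) hr (by linarith)
  have hF : ∃ᶠ X : ℝ in atTop, SimSolvable v η₁ X :=
    frequently_of_frequently_rpow (p := p') (by linarith) ((hfreq.and_eventually
      (eventually_simSolvable_of_hasSimPoint v (((n : ℝ) + 1) ^ 2) (by linarith) hη₁p)).mono
        fun T hT => hT.2 hT.1)
  exact (EReal.coe_lt_coe_iff.2 hη₁).trans_le (le_expSup hF)

/-- The lower Khintchine inequality is strict if `ŵ > n ≥ 2`. -/
theorem not_khintchineLeftEq {n : ℕ} {v : Fin n → ℝ} (hn : 2 ≤ n)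
    (hlt : ((n : ℝ) : EReal) < wHatVec v) : ¬ KhintchineLeftEq n (lamVec v) (wVec v) := by
  have hn2 : (2 : ℝ) ≤ n := by exact_mod_cast hn
  have hn' : (0 : ℝ) < n := by linarith
  obtain ⟨η', hη', hη'lt⟩ := EReal.lt_iff_exists_real_btwn.1 hlt
  rw [EReal.coe_lt_coe_iff] at hη'
  have hη'w : (η' : EReal) < wVec v := hη'lt.trans_le (wHatVec_le_wVec v)
  have hη'0 : 0 < η' := hn'.trans hη'
  intro heq
  rw [KhintchineLeftEq, khintchineLower] at heq
  by_cases htop : wVec v = ⊤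
  · rw [if_pos htop, if_neg (by omega)] at heq
    refine absurd heq.symm (ne_of_lt (lt_lamVec_of_lt_wHatVec hn hη' hη'lt le_rfl ?_ ?_))
    · intro s' hs'
      refine ⟨max η' (1 / s' + 1), le_max_left _ _, by rw [htop]; exact EReal.coe_lt_top _, ?_⟩
      rw [one_div_lt (lt_max_of_lt_left hη'0) hs']
      exact lt_max_of_lt_right (by linarith)
    · have : (n : ℝ) - 1 ≠ 0 := by linarith
      field_simp
      ring
  · obtain ⟨w, hw⟩ : ∃ w : ℝ, wVec v = w :=
      ⟨(wVec v).toReal, (EReal.coe_toReal htop (ne_bot_of_gt hη'w)).symm⟩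
    rw [hw, EReal.coe_lt_coe_iff] at hη'w
    have hw0 : 0 < w := hη'0.trans hη'w
    rw [if_neg htop, hw] at heq
    have heq' : lamVec v = ((w / ((n - 1) * w + n) : ℝ) : EReal) := by
      rw [heq, EReal.coe_div]
      push_cast
      rfl
    refine absurd heq'.symm (ne_of_lt (lt_lamVec_of_lt_wHatVec (s := 1 / w) hn hη' hη'lt
      (by positivity) ?_ ?_))
    · intro s' hs'
      have hs'0 : 0 < s' := lt_trans (by positivity) hs'
      obtain ⟨η, hη, hηw⟩ := exists_between
        (max_lt hη'w ((one_div_lt hw0 hs'0).1 hs'))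
      obtain ⟨h1, h2⟩ := max_lt_iff.1 hη
      refine ⟨η, h1.le, by rw [hw]; exact EReal.coe_lt_coe_iff.2 hηw, ?_⟩
      exact (one_div_lt hs'0 (hη'0.trans h1)).1 h2
    · have : 0 < ((n : ℝ) - 1) * w + n := by nlinarith
      rw [div_mul_eq_mul_div, div_eq_div_iff this.ne' hn'.ne']
      field_simp
      ring

theorem uniform_exponents_eq_of_le {n : ℕ} {v : Fin n → ℝ} (hn : 0 < n)
    (hv : NoIntegerRelation v)
    (h : wHatVec v ≤ ((n : ℝ) : EReal)) :
    lamHatVec v = ((1 / (n : ℝ) : ℝ) : EReal) ∧ wHatVec v = (n : EReal) :=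
  ⟨le_antisymm (lamHatVec_le_of_wHatVec_le hn hv h) (one_div_le_lamHatVec v hn),
    le_antisymm h (le_wHatVec hv)⟩

theorem uniform_exponents_eq {n : ℕ} {v : Fin n → ℝ} (hn : 0 < n)
    (hv : NoIntegerRelation v)
    (h : (KhintchineRightEq n (lamVec v) (wVec v) ∧ lamVec v ≠ ⊤) ∨
      KhintchineLeftEq n (lamVec v) (wVec v)) :
    lamHatVec v = ((1 / (n : ℝ) : ℝ) : EReal) ∧ wHatVec v = (n : EReal) := by
  refine uniform_exponents_eq_of_le hn hv ?_
  rcases h with ⟨h, htop⟩ | h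
  · refine wHatVec_le_of_lamHatVec_le hn ?_
    by_contra! hlt
    exact not_khintchineRightEq hn hv hlt htop h
  · by_cases hn1 : n = 1
    · exact wHatVec_le_of_lamHatVec_le hn (lamHatVec_le_of_eq_one hn1 hv)
    · by_contra! hlt
      exact not_khintchineLeftEq (by omega) hlt h

/-! ### The Veronese curve -/

/-- The polynomial `a₀ + a₁ T + ⋯ + aₙ Tⁿ` attached to a linear form. -/
noncomputable def formPoly {n : ℕ} (a₀ : ℤ) (a : Fin n → ℤ) : ℤ[X] :=
  C a₀ + ∑ i : Fin n, monomial ((i : ℕ) + 1) (a i)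

theorem formPoly_coeff_zero {n : ℕ} (a₀ : ℤ) (a : Fin n → ℤ) : (formPoly a₀ a).coeff 0 = a₀ := by
  simp [formPoly, coeff_monomial]

theorem formPoly_coeff_succ {n : ℕ} (a₀ : ℤ) (a : Fin n → ℤ) (i : Fin n) :
    (formPoly a₀ a).coeff ((i : ℕ) + 1) = a i := by
  rw [formPoly, coeff_add, coeff_C_succ]
  simp [coeff_monomial, Fin.val_inj]

theorem formPoly_natDegree_le {n : ℕ} (a₀ : ℤ) (a : Fin n → ℤ) :
    (formPoly a₀ a).natDegree ≤ n := by
  refine natDegree_add_le_of_degree_le (by simp) (natDegree_sum_le_of_forall_le _ _ fun i _ => ?_)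
  exact (natDegree_monomial_le _).trans i.2

theorem aeval_formPoly {n : ℕ} (a₀ : ℤ) (a : Fin n → ℤ) (ζ : ℝ) :
    aeval ζ (formPoly a₀ a) = (a₀ : ℝ) + ∑ i, (a i : ℝ) * veronese n ζ i := by
  simp [formPoly, veronese, aeval_monomial]

theorem polySolvable_iff {n : ℕ} {ζ η X : ℝ} :
    PolySolvable n ζ η X ↔ FormSolvable (veronese n ζ) η X := by
  constructor
  · rintro ⟨P, hP, hX, hpos, hle⟩
    have h : aeval ζ P =
        (P.coeff 0 : ℝ) + ∑ i : Fin n, (P.coeff ((i : ℕ) + 1) : ℝ) * veronese n ζ i := by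
      rw [aeval_eq_sum_range' (Nat.lt_succ_of_le hP), Finset.sum_range, Fin.sum_univ_succ]
      simp [veronese]
    exact ⟨P.coeff 0, fun i => P.coeff ((i : ℕ) + 1), ⟨hX 0, fun i => hX _⟩, h ▸ hpos, h ▸ hle⟩
  · rintro ⟨a₀, a, ⟨h0, h1⟩, hpos, hle⟩
    refine ⟨formPoly a₀ a, formPoly_natDegree_le a₀ a, fun k => ?_, ?_, ?_⟩
    · rcases Nat.lt_or_ge n k with hk | hk
      · rw [coeff_eq_zero_of_natDegree_lt ((formPoly_natDegree_le a₀ a).trans_lt hk)]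
        simpa using (abs_nonneg _).trans h0
      · rcases k with _ | k
        · rwa [formPoly_coeff_zero]
        · rw [formPoly_coeff_succ a₀ a ⟨k, hk⟩]
          exact h1 _
    · rwa [aeval_formPoly]
    · rwa [aeval_formPoly]

theorem wExp_eq (n : ℕ) (ζ : ℝ) : wExp n ζ = wVec (veronese n ζ) := by
  simp only [wExp, wVec, polySolvable_iff]

theorem wHat_eq (n : ℕ) (ζ : ℝ) : wHat n ζ = wHatVec (veronese n ζ) := by
  simp only [wHat, wHatVec, polySolvable_iff]

theorem noIntegerRelation_veronese {ζ : ℝ} (hζ : Transcendental ℚ ζ) (n : ℕ) :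
    NoIntegerRelation (veronese n ζ) := by
  intro a₀ a h
  have hζ' : Transcendental ℤ ζ := hζ.restrictScalars (algebraMap ℤ ℚ).injective_int
  have hP : formPoly a₀ a = 0 := by
    by_contra hP
    exact hζ' ⟨_, hP, by rw [aeval_formPoly, h]⟩
  refine ⟨by rw [← formPoly_coeff_zero a₀ a, hP, coeff_zero], funext fun i => ?_⟩
  rw [← formPoly_coeff_succ a₀ a i, hP, coeff_zero, Pi.zero_apply]

theorem noIntegerRelation_of_linearIndependent {n : ℕ} {v : Fin n → ℝ}
    (hv : LinearIndependent ℚ (Fin.cons 1 v : Fin (n + 1) → ℝ)) : NoIntegerRelation v := by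
  intro a₀ a h
  have h1 := Fintype.linearIndependent_iff.1 hv (Fin.cons (a₀ : ℚ) fun i => (a i : ℚ)) (by
    rw [Fin.sum_univ_succ]
    simpa [Rat.smul_def] using h)
  refine ⟨by simpa using h1 0, funext fun i => ?_⟩
  simpa using h1 i.succ

/-! ### Liouville numbers -/

/-- If `λ_n(ζ) = ∞` then `ζ` has approximations of arbitrarily high order by rational numbers with
arbitrarily large reduced denominators. -/
theorem exists_rat_approx {n : ℕ} {ζ : ℝ} (hn : 0 < n) (hζ : Transcendental ℚ ζ)
    (h : lam n ζ = ⊤) {M : ℝ} (hM : 0 < M) (N : ℕ) :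
    ∃ r : ℚ, N < r.den ∧ |ζ - r| ≤ (r.den : ℝ) ^ (-M) := by
  obtain ⟨c₁, hc₁, h₁⟩ := exists_pos_le_error (v := veronese n ζ) hn
    (noIntegerRelation_veronese hζ _) 0
  obtain ⟨c₂, hc₂, h₂⟩ := exists_pos_le_error (v := veronese 1 ζ) one_pos
    (noIntegerRelation_veronese hζ _) N
  have hfreq : ∃ᶠ X : ℝ in atTop, SimSolvable (veronese n ζ) M X :=
    frequently_simSolvable_of_lt_lamVec (by
      rw [← lam, h]; exact EReal.coe_lt_top M)
  have hsmall := tendsto_rpow_neg_atTop hM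
  obtain ⟨X, ⟨x, y, hne, hxX, hyX⟩, hX₁, hX₂⟩ := (hfreq.and_eventually
    ((hsmall.eventually_lt_const hc₁).and (hsmall.eventually_lt_const hc₂))).exists
  have hx0 : x ≠ 0 := by
    rintro rfl
    exact absurd (h₁ 0 y _ hne (by simp) hyX) (not_le.2 hX₁)
  set y₀ := y ⟨0, hn⟩
  have herr : |ζ * x - y₀| ≤ X ^ (-M) := by
    simpa [veronese] using hyX ⟨0, hn⟩
  set r : ℚ := (y₀ : ℚ) / x with hr
  have hdvd : (r.den : ℤ) ∣ x := by
    rw [hr, ← Rat.divInt_eq_div]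
    exact Rat.den_dvd _ _
  have hdenx : (r.den : ℝ) ≤ |(x : ℝ)| := by
    have := Int.le_of_dvd (abs_pos.2 hx0) ((dvd_abs _ _).2 hdvd)
    rw [← Int.cast_abs]
    exact_mod_cast this
  have hx1 : 0 < |(x : ℝ)| := abs_pos.2 (by exact_mod_cast hx0)
  have hden0 : (0 : ℝ) < r.den := by exact_mod_cast r.den_pos
  have hmul : |(x : ℝ)| * |ζ - r| = |ζ * x - y₀| := by
    rw [← abs_mul, hr]
    push_cast
    have : (x : ℝ) ≠ 0 := by exact_mod_cast hx0
    congr 1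
    field_simp
  have hden : (r.den : ℝ) * |ζ - r| ≤ X ^ (-M) :=
    (mul_le_mul_of_nonneg_right hdenx (abs_nonneg _)).trans (hmul.le.trans herr)
  refine ⟨r, ?_, ?_⟩
  · by_contra! hle
    refine absurd (h₂ r.den (fun _ => r.num) _ (Or.inl (by exact_mod_cast r.den_nz))
      (by simpa using hle) (fun i => ?_)) (not_le.2 hX₂)
    refine le_trans (le_of_eq ?_) hden
    have hrn : (r.den : ℝ) * r = r.num := by exact_mod_cast Rat.den_mul_eq_num r
    rw [show (r.den : ℝ) * |ζ - r| = |(r.den : ℝ) * (ζ - r)| by rw [abs_mul, abs_of_pos hden0],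
      mul_sub, hrn]
    simp [veronese, Fin.fin_one_eq_zero i, mul_comm]
  · have h1 : |ζ - r| ≤ X ^ (-M) := by
      refine le_trans (le_mul_of_one_le_left (abs_nonneg _) ?_) hden
      exact_mod_cast r.den_pos
    exact h1.trans (Real.rpow_le_rpow_of_nonpos hden0 (hdenx.trans hxX) (by linarith))

/-- A polynomial of height less than the denominator of `r` does not vanish at `r`, as that
denominator would divide its leading coefficient. Its value there is thus a nonzero rational number
whose denominator divides `r.den ^ n`. -/
theorem one_le_den_pow_mul_abs_aeval {n : ℕ} {P : ℤ[X]} {r : ℚ} (hP : P.natDegree ≤ n)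
    (hP0 : P ≠ 0) (hlt : ∀ i, |P.coeff i| < r.den) :
    (1 : ℝ) ≤ (r.den : ℝ) ^ n * |aeval (r : ℝ) P| := by
  have hroot : aeval r P ≠ 0 := by
    intro h
    have h1 := den_dvd_of_is_root h
    have h2 : (r.den : ℤ) ∣ P.leadingCoeff := by
      rw [← Rat.isFractionRingDen r]
      exact Int.natAbs_dvd.2 h1
    have h3 : P.leadingCoeff ≠ 0 := leadingCoeff_ne_zero.2 hP0
    have h4 := Int.le_of_dvd (abs_pos.2 h3) ((dvd_abs _ _).2 h2)
    exact absurd (hlt P.natDegree) (not_lt.2 h4)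
  have hcast : aeval (r : ℝ) P = ((aeval r P : ℚ) : ℝ) := by
    simpa using (aeval_algebraMap_apply ℝ r P)
  have hr : ((r.num : ℝ) / ((r.den : ℤ) : ℝ)) = (r : ℝ) := by
    rw [Rat.cast_def]; simp
  have h1 := one_le_pow_mul_abs_eval_div (K := ℝ) (f := P) (a := r.num) (b := r.den)
    (by exact_mod_cast r.den_pos) (by
      rw [hr, eval_map_algebraMap, hcast]
      exact_mod_cast hroot)
  rw [hr, eval_map_algebraMap] at h1
  refine h1.trans (mul_le_mul_of_nonneg_right ?_ (abs_nonneg _))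
  rw [Int.cast_natCast]
  exact pow_le_pow_right₀ (by exact_mod_cast r.den_pos) hP

theorem abs_aeval_sub_aeval_le {n : ℕ} {P : ℤ[X]} (hP : P.natDegree ≤ n) {H R x y : ℝ}
    (hH : ∀ i, |(P.coeff i : ℝ)| ≤ H) (hR : 1 ≤ R) (hx : |x| ≤ R) (hy : |y| ≤ R) :
    |aeval x P - aeval y P| ≤ (n + 1) * n * R ^ n * H * |x - y| := by
  have hlt := Nat.lt_succ_of_le hP
  have hH0 : 0 ≤ H := (abs_nonneg _).trans (hH 0)
  rw [aeval_eq_sum_range' hlt, aeval_eq_sum_range' hlt, ← Finset.sum_sub_distrib]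
  refine (Finset.abs_sum_le_sum_abs _ _).trans ?_
  have hterm : ∀ i ∈ Finset.range (n + 1), |P.coeff i • x ^ i - P.coeff i • y ^ i|
      ≤ H * (|x - y| * n * R ^ n) := by
    intro i hi
    have hin : i ≤ n := Nat.lt_succ_iff.1 (Finset.mem_range.1 hi)
    rw [← smul_sub, zsmul_eq_mul, abs_mul]
    refine mul_le_mul (hH i) ((abs_pow_sub_pow_le x y i).trans ?_) (abs_nonneg _) hH0
    have h1 : max |x| |y| ^ (i - 1) ≤ R ^ n :=
      (pow_le_pow_left₀ (le_max_of_le_left (abs_nonneg _)) (max_le hx hy) _).trans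
        (pow_le_pow_right₀ hR (by omega))
    gcongr
  refine (Finset.sum_le_card_nsmul _ _ _ hterm).trans (le_of_eq ?_)
  rw [Finset.card_range, nsmul_eq_mul]
  push_cast
  ring

/-- Between a rational approximation with denominator `q` and the polynomials of height at most
`q / 2` there is repulsion, which keeps `ŵ_n(ζ)` at `n` when `ζ` is a Liouville number. -/
theorem wHat_le_of_lam_eq_top {n : ℕ} {ζ : ℝ} (hn : 0 < n) (hζ : Transcendental ℚ ζ)
    (h : lam n ζ = ⊤) : wHatVec (veronese n ζ) ≤ ((n : ℝ) : EReal) := by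
  by_contra! hlt
  obtain ⟨η, hη, hlt⟩ := lt_expSup_iff.1 hlt
  have hηn : (n : ℝ) < η := EReal.coe_lt_coe_iff.1 hlt
  have hpoly : ∀ᶠ X : ℝ in atTop, PolySolvable n ζ η X :=
    (show ∀ᶠ X : ℝ in atTop, FormSolvable (veronese n ζ) η X from hη).mono
      fun X hX => polySolvable_iff.2 hX
  set R : ℝ := |ζ| + 1 with hR
  have hR1 : 1 ≤ R := by linarith [abs_nonneg ζ]
  set K : ℝ := (n + 1) * n * R ^ n with hK
  have hev : ∀ᶠ q : ℝ in atTop, PolySolvable n ζ η (q / 2) ∧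
      2 * 2 ^ η * q ^ (-η) < q ^ (-(n : ℝ)) ∧ 2 * K * q ^ (-(n : ℝ) - 1) < q ^ (-(n : ℝ)) ∧
      1 ≤ q :=
    ((tendsto_id.atTop_div_const two_pos).eventually hpoly).and
      ((eventually_const_mul_rpow_lt _ (by linarith)).and
        ((eventually_const_mul_rpow_lt _ (by linarith)).and (eventually_ge_atTop 1)))
  obtain ⟨Q, hQ⟩ := eventually_atTop.1 hev
  obtain ⟨N, hN⟩ := exists_nat_ge Q
  obtain ⟨r, hrN, hr⟩ := exists_rat_approx hn hζ h (M := n + 2) (by positivity) N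
  set q : ℝ := (r.den : ℝ) with hq
  have hNq : (N : ℝ) ≤ q := Nat.cast_le.2 hrN.le
  obtain ⟨⟨P, hP, hPX, hPpos, hPle⟩, hq1, hq2, hq3⟩ := hQ q (hN.trans hNq)
  have hq0 : 0 < q := by linarith
  have hP0 : P ≠ 0 := by
    rintro rfl
    simp at hPpos
  have hlow : (1 : ℝ) ≤ q ^ n * |aeval (r : ℝ) P| :=
    one_le_den_pow_mul_abs_aeval hP hP0 fun i => by
      have h1 : |(P.coeff i : ℝ)| < r.den := (hPX i).trans_lt (by linarith)
      rw [← Int.cast_abs] at h1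
      exact_mod_cast h1
  have hlow' : q ^ (-(n : ℝ)) ≤ |aeval (r : ℝ) P| := by
    rw [Real.rpow_neg hq0.le, Real.rpow_natCast, inv_le_iff_one_le_mul₀' (by positivity)]
    exact hlow
  have hclose : |ζ - r| ≤ 1 := hr.trans
    (Real.rpow_le_one_of_one_le_of_nonpos hq3 (by linarith [n.cast_nonneg (α := ℝ)]))
  have hrR : |(r : ℝ)| ≤ R := by
    have := abs_sub_abs_le_abs_sub (r : ℝ) ζ
    rw [abs_sub_comm] at this
    linarith
  have hdiff := abs_aeval_sub_aeval_le hP hPX hR1 (by linarith : |ζ| ≤ R) hrR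
  -- One factor `q` of `q ^ (-(n + 2))` is lost to the height of `P`; the remaining exponent `-n - 1`
  -- is still below `-n`.
  have hdiff' : |aeval ζ P - aeval (r : ℝ) P| ≤ K * q ^ (-(n : ℝ) - 1) := by
    refine hdiff.trans ?_
    have h1 : q ^ (-(n : ℝ) - 1) = q * q ^ (-((n : ℝ) + 2)) := by
      rw [← Real.rpow_one_add' hq0.le (by linarith [n.cast_nonneg (α := ℝ)])]
      congr 1; ring
    have hK0 : 0 ≤ K := by positivity
    rw [h1, ← hK, ← mul_assoc]
    refine mul_le_mul (mul_le_mul_of_nonneg_left (by linarith) hK0) hr (abs_nonneg _)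
      (by positivity)
  have hPle' : |aeval ζ P| ≤ 2 ^ η * q ^ (-η) := by
    refine hPle.trans (le_of_eq ?_)
    rw [Real.div_rpow hq0.le two_pos.le, Real.rpow_neg two_pos.le, div_inv_eq_mul, mul_comm]
  have htri : |aeval (r : ℝ) P| ≤ |aeval ζ P| + |aeval ζ P - aeval (r : ℝ) P| := by
    have := abs_sub_abs_le_abs_sub (aeval (r : ℝ) P) (aeval ζ P)
    rw [abs_sub_comm] at this
    linarith
  linarith

theorem lemma3p1 (n : ℕ) (hn : 1 ≤ n) :
    (∀ ζ : ℝ, Transcendental ℚ ζ →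
      (KhintchineRightEq n (lam n ζ) (wExp n ζ) ∨ KhintchineLeftEq n (lam n ζ) (wExp n ζ)) →
      lamHat n ζ = ((1 / (n : ℝ) : ℝ) : EReal) ∧ wHat n ζ = (n : EReal)) ∧
    (∀ v : Fin n → ℝ, LinearIndependent ℚ (Fin.cons 1 v : Fin (n + 1) → ℝ) →
      ((KhintchineRightEq n (lamVec v) (wVec v) ∧ lamVec v ≠ ⊤) ∨
        KhintchineLeftEq n (lamVec v) (wVec v)) →
      lamHatVec v = ((1 / (n : ℝ) : ℝ) : EReal) ∧ wHatVec v = (n : EReal)) := by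
  refine ⟨fun ζ hζ h => ?_, fun v hv h =>
    uniform_exponents_eq hn (noIntegerRelation_of_linearIndependent hv) h⟩
  have hv := noIntegerRelation_veronese hζ n
  rw [wHat_eq, lamHat]
  by_cases htop : lam n ζ = ⊤
  · exact uniform_exponents_eq_of_le hn hv (wHat_le_of_lam_eq_top hn hζ htop)
  · rw [wExp_eq] at h
    exact uniform_exponents_eq hn hv (h.imp_left fun h => ⟨h, htop⟩)
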